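/- Let $1\le k\le\infty$ and let $(X,\mathcal F)$ be a Hilbert lamination of class $C^k$: $X$ is a Polish space covered by the domains of foliated charts $\varphi_i:U_i\to H_i\times P_i$, which are homeomorphisms from open subsets $U_i\subset X$ onto the product of a separable real Hilbert space $H_i$ (possibly of finite dimension) and a Polish space $P_i$, such that the changes of coordinates are locally of the form $(x,s)\mapsto(f(x,s),g(s))$ with $f$ of class $C^k$ in $x$ and all its $x$-derivatives of order $\le k$ continuous in $(x,s)$ (for the operator norm). A map from $X$ to a normed space is of class $C^r$ if, in every foliated chart, it is $C^r$ in $x$ with $x$-derivatives of order $\le r$ continuous in $(x,s)$. Then there is a smooth $C^k$ embedding $\varphi$ of $X$ in the separable real Hilbert space $\mathbb E=\ell^2(\mathbb N,\mathbb R)$, i.e. a map $\varphi:X\to\mathbb E$ of class $C^k$ that is a homeomorphism onto its image and whose leafwise differentials are injective with closed range. Moreover, any given metric tensor along the leaves extends to a metric tensor on $\mathbb E$: for every $r$ with $r+1\le k$ and every metric tensor $g$ of class $C^r$ along the leaves (inner products on the tangent spaces of the leaves, inducing their Hilbert space topology, of class $C^r$ in the foliated charts), there is a continuous field $G$ of inner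 products on the tangent spaces $T_y\mathbb E=\mathbb E$, each inducing the topology of $\mathbb E$, such that $G_{\varphi(x)}(d\varphi\, u,d\varphi\, v)=g_x(u,v)$ for all $x\in X$ and all $u,v$ tangent at $x$ to the leaf through $x$, and such that $x\mapsto G_{\varphi(x)}$ is of class $C^r$ on $X$. -/

import Mathlib

open Set Topology

/-- Let `H` be the leaf direction and `P` the transverse direction. A map `F` on an open subset `W`
of `H × P` is leafwise `C^k` when it is `C^k` along each plaque and all its leafwise derivatives of
order at most `k` are (jointly) continuous on `W`, for the operator norm. -/
def LeafwiseContDiffOn {H P F : Type*} [NormedAddCommGroup H] [NormedSpace ℝ H]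
    [TopologicalSpace P] [NormedAddCommGroup F] [NormedSpace ℝ F]
    (k : ℕ∞) (f : H × P → F) (W : Set (H × P)) : Prop :=
  (∀ s : P, ContDiffOn ℝ (k : WithTop ℕ∞) (fun x : H => f (x, s)) {x : H | (x, s) ∈ W}) ∧
    ∀ j : ℕ, (j : ℕ∞) ≤ k →
      ContinuousOn (fun p : H × P => iteratedFDeriv ℝ j (fun x : H => f (x, p.2)) p.1) W

/-- The leafwise derivative of a map on `H × P` at a point. -/
noncomputable def leafwiseFDeriv {H P F : Type*} [NormedAddCommGroup H] [NormedSpace ℝ H]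
    [NormedAddCommGroup F] [NormedSpace ℝ F] (f : H × P → F) (p : H × P) : H →L[ℝ] F :=
  fderiv ℝ (fun x : H => f (x, p.2)) p.1

/-- A continuous bilinear form is an inner product inducing the topology of the (Hilbertable)
space on which it is defined: it is symmetric, and bounded below by a multiple of the norm. -/
def IsAdmissibleInner {V : Type*} [NormedAddCommGroup V] [NormedSpace ℝ V]
    (b : V →L[ℝ] V →L[ℝ] ℝ) : Prop :=
  (∀ u v, b u v = b v u) ∧ ∃ c : ℝ, 0 < c ∧ ∀ v, c * ‖v‖ ^ 2 ≤ b v v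

/-- A (Hilbert) lamination of class `C^k` on the space `X`, given by a foliated atlas
whose charts are homeomorphisms from open subsets of `X` onto products `H i × P i`.
The changes of coordinates are locally of the form `(x, s) ↦ (f (x, s), g s)`,
with `f` leafwise `C^k`. -/
structure HilbertLamination (k : ℕ∞) (X : Type*) [TopologicalSpace X] {ι : Type*}
    (H P : ι → Type*) [∀ i, NormedAddCommGroup (H i)] [∀ i, InnerProductSpace ℝ (H i)]
    [∀ i, TopologicalSpace (P i)] where
  /-- The foliated charts. -/
  chart : ∀ i, OpenPartialHomeomorph X (H i × P i)
  target_eq : ∀ i, (chart i).target = univ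
  cover : ∀ x : X, ∃ i, x ∈ (chart i).source
  /-- The leaf component of a change of coordinates is leafwise `C^k`. -/
  leafwise_contDiffOn : ∀ i j, LeafwiseContDiffOn k
    (fun p : H i × P i => (chart j ((chart i).symm p)).1) ((chart i).symm.trans (chart j)).source
  /-- The transverse component depends locally only on the transverse coordinate. -/
  transverse : ∀ i j, ∀ p ∈ ((chart i).symm.trans (chart j)).source,
    ∃ W ∈ 𝓝 p, ∃ g : P i → P j, ∀ q ∈ W, (chart j ((chart i).symm q)).2 = g q.2

namespace HilbertLamination

variable {k : ℕ∞} {X : Type*} [TopologicalSpace X] {ι : Type*} {H P : ι → Type*}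
  [∀ i, NormedAddCommGroup (H i)] [∀ i, InnerProductSpace ℝ (H i)] [∀ i, TopologicalSpace (P i)]

/-- A map from the lamination to a normed space is of class `C^r` if it is leafwise `C^r`
in the foliated charts. -/
def IsContDiff (L : HilbertLamination k X H P) (r : ℕ∞)
    {F : Type*} [NormedAddCommGroup F] [NormedSpace ℝ F] (f : X → F) : Prop :=
  ∀ i, LeafwiseContDiffOn r (fun p : H i × P i => f ((L.chart i).symm p)) univ

/-- The leafwise differential of a map `f` on the lamination, read in the chart `i` at the point
with coordinates `p`. -/
noncomputable def leafDifferential (L : HilbertLamination k X H P)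
    {F : Type*} [NormedAddCommGroup F] [NormedSpace ℝ F] (f : X → F) (i : ι) (p : H i × P i) :
    H i →L[ℝ] F :=
  leafwiseFDeriv (fun q : H i × P i => f ((L.chart i).symm q)) p

/-- A `C^k` embedding of the lamination in a Hilbert space: a `C^k` map which is a homeomorphism
onto its image and an immersion along the leaves (its leafwise differentials are injective with
closed, hence complemented, range). -/
structure IsSmoothEmbedding (L : HilbertLamination k X H P)
    {E : Type*} [NormedAddCommGroup E] [InnerProductSpace ℝ E] (φ : X → E) : Prop where
  contDiff : L.IsContDiff k φ
  isEmbedding : IsEmbedding φ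
  injective : ∀ i p, Function.Injective (L.leafDifferential φ i p)
  isClosed_range : ∀ i p, IsClosed (range (L.leafDifferential φ i p))

/-- A metric tensor of class `C^r` along the leaves: a field of inner products on the tangent
spaces of the leaves, given by its expressions in the foliated charts, which agree under
the changes of coordinates. -/
structure LeafwiseMetric (L : HilbertLamination k X H P) (r : ℕ∞) where
  /-- The expression of the metric in a foliated chart. -/
  form : ∀ i, H i × P i → (H i →L[ℝ] H i →L[ℝ] ℝ)
  admissible : ∀ i p, IsAdmissibleInner (form i p)
  compatible : ∀ i j, ∀ p ∈ ((L.chart i).symm.trans (L.chart j)).source, ∀ u v : H i,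
    form i p u v = form j (L.chart j ((L.chart i).symm p))
      (leafwiseFDeriv (fun q : H i × P i => (L.chart j ((L.chart i).symm q)).1) p u)
      (leafwiseFDeriv (fun q : H i × P i => (L.chart j ((L.chart i).symm q)).1) p v)
  contDiff : ∀ i, LeafwiseContDiffOn r (form i) univ

end HilbertLamination

/-- A metric tensor on a Hilbert space `E`: a continuous field of inner products on its tangent
spaces, each of them inducing the topology of `E`. -/
structure IsMetricTensor {E : Type*} [NormedAddCommGroup E] [InnerProductSpace ℝ E]
    (G : E → (E →L[ℝ] E →L[ℝ] ℝ)) : Prop where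
  continuous : Continuous G
  admissible : ∀ y, IsAdmissibleInner (G y)

/-- The metric tensor `G` on `E` extends the leafwise metric `g` of a lamination
mapped to `E` by `φ`: the pull-back of `G` to the leaves is `g`. -/
def HilbertLamination.LeafwiseMetric.IsExtendedBy {k : ℕ∞} {X : Type*} [TopologicalSpace X]
    {ι : Type*} {H P : ι → Type*}
    [∀ i, NormedAddCommGroup (H i)] [∀ i, InnerProductSpace ℝ (H i)] [∀ i, TopologicalSpace (P i)]
    {L : HilbertLamination k X H P} {r : ℕ∞} (g : L.LeafwiseMetric r)
    {E : Type*} [NormedAddCommGroup E] [InnerProductSpace ℝ E] (φ : X → E)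
    (G : E → (E →L[ℝ] E →L[ℝ] ℝ)) : Prop :=
  ∀ i (p : H i × P i) (u v : H i),
    G (φ ((L.chart i).symm p)) (L.leafDifferential φ i p u) (L.leafDifferential φ i p v)
      = g.form i p u v

/-!
The embedding. Hilbert spaces carry smooth bump functions and Polish spaces Urysohn functions, so
the lamination has countable locally finite partitions of unity `ψₙ` of class `C^k`, normalized by
`∑ ψₙ² = 1` and subordinate to foliated charts `z ↦ (xₙ, sₙ)` (`exists_partition`). The map `φ =
(ψₙ, ψₙ • xₙ, ψₙ • θₙ(sₙ))ₙ`, with values in a Hilbert sum of copies of `ℓ²`, is of class `C^k`;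
here `θₙ` is an embedding of the `n`-th transversal in `ℓ²`, and only its continuity matters for
the regularity of `φ`. If `φ` converges along a filter, then the unit vectors `(ψₙ)ₙ` converge to
a unit vector, so some `ψₙ` has a nonzero limit; dividing by it, `xₙ` and `θₙ(sₙ)` converge. If
`θₙ` is a *closed* embedding, which exists for every Polish space
(`PolishSpace.exists_isClosedEmbedding_l2`), it follows that the filter converges in the
lamination. Hence `φ` is a closed embedding (`exists_isClosedEmbedding`). The same division gives
a local left inverse of `φ` that is differentiable along the plaques, so the leafwise
differentials are left invertible.

The metric. A left inverse of the leafwise differential `D` of `φ` at one point can be corrected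
to a left inverse `B` at the nearby points, of class `C^r`, and then `g(B u, B v) + ⟨u - D B u, v
- D B v⟩` extends `g` locally (`exists_local_extension`). The extensions at a point form a convex
set, so a partition of unity provides an extension along the image of `φ`
(`exists_extension_along`). As that image is closed, Dugundji's theorem extends this field of
inner products continuously to `ℓ²`, with values in the convex set of inner products
(`Topology.IsClosedEmbedding.exists_extension_mem_convex`).

The calculus behind this is that of maps of class `C^k` along the leaves; its chain rule for
changes of variables `(x, s) ↦ (f (x, s), g s)` is read off from Faà di Bruno's formula
(`LeafwiseContDiffOn.comp`).
-/

open scoped lp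

/-! ### Leafwise differential calculus on products -/

theorem IsOpen.plaque {H P : Type*} [TopologicalSpace H] [TopologicalSpace P] {W : Set (H × P)}
    (hW : IsOpen W) (s : P) : IsOpen {x : H | (x, s) ∈ W} :=
  hW.preimage (by fun_prop : Continuous fun x : H => (x, s))

section LeafwiseCalculus

variable {H P F G : Type*} [NormedAddCommGroup H] [NormedSpace ℝ H] [TopologicalSpace P]
  [NormedAddCommGroup F] [NormedSpace ℝ F] [NormedAddCommGroup G] [NormedSpace ℝ G]
  {k r : ℕ∞} {f f' : H × P → F} {W W' : Set (H × P)}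

namespace LeafwiseContDiffOn

theorem mono (hf : LeafwiseContDiffOn k f W) (h : W' ⊆ W) : LeafwiseContDiffOn k f W' :=
  ⟨fun s => (hf.1 s).mono fun _ hx => h hx, fun j hj => (hf.2 j hj).mono h⟩

theorem of_le (hf : LeafwiseContDiffOn k f W) (h : r ≤ k) : LeafwiseContDiffOn r f W :=
  ⟨fun s => (hf.1 s).of_le (by exact_mod_cast h), fun j hj => hf.2 j (hj.trans h)⟩

theorem contDiffAt (hf : LeafwiseContDiffOn k f W) (hW : IsOpen W) {p : H × P} (hp : p ∈ W) :
    ContDiffAt ℝ (k : WithTop ℕ∞) (fun x : H => f (x, p.2)) p.1 :=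
  (hf.1 p.2).contDiffAt ((hW.plaque p.2).mem_nhds hp)

theorem continuousOn (hf : LeafwiseContDiffOn k f W) : ContinuousOn f W := by
  have h := hf.2 0 (by simp)
  have h2 := (continuousMultilinearCurryFin0 ℝ H F).continuous.comp_continuousOn h
  refine h2.congr fun p _ => ?_
  simp [iteratedFDeriv_zero_eq_comp]

/-- Being leafwise `C^k` is a local property. -/
theorem of_forall_mem (h : ∀ p ∈ W, ∃ U, IsOpen U ∧ p ∈ U ∧ LeafwiseContDiffOn k f U) :
    LeafwiseContDiffOn k f W := by
  refine ⟨fun s x hx => ?_, fun j hj p hp => ?_⟩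
  · obtain ⟨U, hU, hpU, hfU⟩ := h _ hx
    exact (hfU.contDiffAt hU hpU).contDiffWithinAt
  · obtain ⟨U, hU, hpU, hfU⟩ := h _ hp
    exact ((hfU.2 j hj).continuousAt (hU.mem_nhds hpU)).continuousWithinAt

theorem congr (hf : LeafwiseContDiffOn k f W) (hW : IsOpen W) (h : EqOn f' f W) :
    LeafwiseContDiffOn k f' W := by
  refine ⟨fun s => (hf.1 s).congr fun x hx => h hx, fun j hj => (hf.2 j hj).congr fun p hp => ?_⟩
  have : (fun x : H => f' (x, p.2)) =ᶠ[𝓝 p.1] fun x : H => f (x, p.2) :=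
    Filter.eventuallyEq_of_mem ((hW.plaque p.2).mem_nhds hp) fun x hx => h hx
  exact (this.iteratedFDeriv ℝ j).eq_of_nhds

/-- A continuous function of the transverse coordinate only is leafwise smooth. -/
theorem comp_snd {b : P → F} (hb : Continuous b) :
    LeafwiseContDiffOn k (fun p : H × P => b p.2) W := by
  refine ⟨fun s => (contDiffOn_const : ContDiffOn ℝ k (fun _ : H => b s) _), fun j hj => ?_⟩
  rcases Nat.eq_zero_or_pos j with rfl | h
  · simp only [iteratedFDeriv_zero_eq_comp]
    exact ((continuousMultilinearCurryFin0 ℝ H F).symm.continuous.comp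
      (hb.comp continuous_snd)).continuousOn
  · simp only [iteratedFDeriv_const_of_ne h.ne']
    exact continuousOn_const

/-- A `C^k` function of the leaf coordinate only is leafwise `C^k`. -/
theorem comp_fst {a : H → F} (ha : ContDiff ℝ k a) :
    LeafwiseContDiffOn k (fun p : H × P => a p.1) W :=
  ⟨fun _ => ha.contDiffOn, fun j hj =>
    ((ha.continuous_iteratedFDeriv (m := j) (by exact_mod_cast hj)).comp
      continuous_fst).continuousOn⟩

theorem add (hf : LeafwiseContDiffOn k f W) (hf' : LeafwiseContDiffOn k f' W) (hW : IsOpen W) :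
    LeafwiseContDiffOn k (fun p => f p + f' p) W := by
  refine ⟨fun s => (hf.1 s).add (hf'.1 s), fun j hj => ((hf.2 j hj).add (hf'.2 j hj)).congr ?_⟩
  intro p hp
  have hj' : ((j : ℕ) : WithTop ℕ∞) ≤ (k : WithTop ℕ∞) := by exact_mod_cast hj
  exact iteratedFDeriv_add_apply ((hf.contDiffAt hW hp).of_le hj')
    ((hf'.contDiffAt hW hp).of_le hj')

/-- The leafwise chain rule: a leafwise `C^k` map stays leafwise `C^k` after a change of variables
`τ` of the form `(x, s) ↦ (f (x, s), g s)`. By Faà di Bruno's formula the leafwise derivatives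
of the composition are continuous expressions in those of the factors. -/
theorem comp {H' P' : Type*} [NormedAddCommGroup H'] [NormedSpace ℝ H'] [TopologicalSpace P']
    {h : H' × P' → F} {τ : H × P → H' × P'} {g : P → P'} {V : Set (H' × P')}
    (hh : LeafwiseContDiffOn k h V) (hV : IsOpen V) (hW : IsOpen W)
    (hτ : LeafwiseContDiffOn k (fun p => (τ p).1) W) (hτc : ContinuousOn τ W)
    (hg : ∀ p ∈ W, (τ p).2 = g p.2) (hWV : MapsTo τ W V) :
    LeafwiseContDiffOn k (fun p => h (τ p)) W := by
  have key : ∀ p ∈ W, (fun x : H => h (τ (x, p.2))) =ᶠ[𝓝 p.1]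
      (fun y : H' => h (y, (τ p).2)) ∘ fun x : H => (τ (x, p.2)).1 := by
    intro p hp
    refine Filter.eventuallyEq_of_mem ((hW.plaque p.2).mem_nhds hp) fun x hx => ?_
    show h (τ (x, p.2)) = h ((τ (x, p.2)).1, (τ p).2)
    rw [hg p hp, ← hg _ hx]
  have hat : ∀ p ∈ W, ContDiffAt ℝ (k : WithTop ℕ∞) (fun y : H' => h (y, (τ p).2)) (τ p).1 :=
    fun p hp => hh.contDiffAt hV (hWV hp)
  refine ⟨fun s x hx => ?_, fun j hj => ?_⟩
  · exact (((hat _ hx).comp x (hτ.contDiffAt hW hx)).congr_of_eventuallyEq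
      (key _ hx)).contDiffWithinAt
  · have : ContinuousOn (fun p : H × P =>
        (ftaylorSeries ℝ (fun y : H' => h (y, (τ p).2)) (τ p).1).taylorComp
          (ftaylorSeries ℝ (fun x : H => (τ (x, p.2)).1) p.1) j) W := by
      unfold FormalMultilinearSeries.taylorComp
      refine continuousOn_finsetSum _ fun c _ => ?_
      have hc1 : ContinuousOn (fun p : H × P =>
          iteratedFDeriv ℝ c.length (fun y : H' => h (y, (τ p).2)) (τ p).1) W :=
        (hh.2 c.length (le_trans (by exact_mod_cast c.length_le) hj)).comp hτc hWV
      have hc2 : ContinuousOn (fun (p : H × P) (m : Fin c.length) =>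
          iteratedFDeriv ℝ (c.partSize m) (fun x : H => (τ (x, p.2)).1) p.1) W :=
        continuousOn_pi.2 fun m => hτ.2 _ (le_trans (by exact_mod_cast c.partSize_le m) hj)
      exact (((c.compAlongOrderedFinpartitionL ℝ H H' F).continuous.comp_continuousOn hc1).eval hc2)
    refine this.congr fun p hp => ?_
    show iteratedFDeriv ℝ j (fun x : H => h (τ (x, p.2))) p.1 = _
    rw [((key p hp).iteratedFDeriv ℝ j).eq_of_nhds]
    exact iteratedFDeriv_comp (f := fun x : H => (τ (x, p.2)).1) (hat p hp)
      (hτ.contDiffAt hW hp) (by exact_mod_cast hj)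

theorem contDiffOn_comp {O : Set F} {h : F → G} (hh : ContDiffOn ℝ k h O) (hO : IsOpen O)
    (hf : LeafwiseContDiffOn k f W) (hW : IsOpen W) (hWO : MapsTo f W O) :
    LeafwiseContDiffOn k (fun p => h (f p)) W := by
  have hh' : LeafwiseContDiffOn k (fun q : F × Unit => h q.1) (O ×ˢ univ) := by
    refine ⟨fun s => hh.mono fun x hx => hx.1, fun j hj => ?_⟩
    refine ((hh.continuousOn_iteratedFDerivWithin (m := j) (by exact_mod_cast hj)
      hO.uniqueDiffOn).comp continuous_fst.continuousOn fun x hx => hx.1).congr ?_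
    intro p hp
    exact (iteratedFDerivWithin_of_isOpen j hO hp.1).symm
  exact hh'.comp (τ := fun p => (f p, ())) (g := fun _ => ()) (hO.prod isOpen_univ) hW hf
    (hf.continuousOn.prodMk continuousOn_const) (fun _ _ => rfl) fun p hp => ⟨hWO hp, mem_univ _⟩

theorem contDiff_comp {h : F → G} (hh : ContDiff ℝ k h)
    (hf : LeafwiseContDiffOn k f W) (hW : IsOpen W) :
    LeafwiseContDiffOn k (fun p => h (f p)) W :=
  contDiffOn_comp hh.contDiffOn isOpen_univ hf hW (mapsTo_univ _ _)

theorem prodMk {f' : H × P → G} (hf : LeafwiseContDiffOn k f W) (hf' : LeafwiseContDiffOn k f' W)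
    (hW : IsOpen W) : LeafwiseContDiffOn k (fun p => (f p, f' p)) W := by
  have h1 := contDiff_comp (ContinuousLinearMap.inl ℝ F G).contDiff hf hW
  have h2 := contDiff_comp (ContinuousLinearMap.inr ℝ F G).contDiff hf' hW
  exact (h1.add h2 hW).congr hW fun p _ => by simp

theorem leafwiseFDeriv (hf : LeafwiseContDiffOn k f W) (hW : IsOpen W) (hr : r + 1 ≤ k) :
    LeafwiseContDiffOn r (leafwiseFDeriv f) W := by
  refine ⟨fun s => ?_, fun j hj => ?_⟩
  · exact (hf.1 s).fderiv_of_isOpen (hW.plaque s) (by exact_mod_cast hr)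
  · have h := hf.2 (j + 1) (le_trans (by push_cast; gcongr) hr)
    refine ((continuousMultilinearCurryRightEquiv' ℝ j H F).continuous.comp_continuousOn h).congr ?_
    intro p _
    simp only [Function.comp, iteratedFDeriv_succ_eq_comp_right,
      LinearIsometryEquiv.apply_symm_apply]
    rfl

end LeafwiseContDiffOn

end LeafwiseCalculus

/-! ### Differential calculus and partitions of unity on a lamination -/

namespace HilbertLamination

section Calculus

variable {k : ℕ∞} {X : Type*} [TopologicalSpace X] {ι : Type*} {H P : ι → Type*}
  [∀ i, NormedAddCommGroup (H i)] [∀ i, InnerProductSpace ℝ (H i)] [∀ i, TopologicalSpace (P i)]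
  {L : HilbertLamination k X H P} {r : ℕ∞}
  {F : Type*} [NormedAddCommGroup F] [NormedSpace ℝ F]
  {G : Type*} [NormedAddCommGroup G] [NormedSpace ℝ G]

/-- A map on a lamination is of class `C^r` near `x` if, in every foliated chart around `x`,
it is leafwise `C^r` on some neighbourhood of the point. For `r = ∞` one neighbourhood has to serve
for all orders of differentiation. -/
def IsContDiffAt (L : HilbertLamination k X H P) (r : ℕ∞) (f : X → F) (x : X) : Prop :=
  ∀ i, x ∈ (L.chart i).source → ∃ U, IsOpen U ∧ L.chart i x ∈ U ∧
    LeafwiseContDiffOn r (fun p : H i × P i => f ((L.chart i).symm p)) U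

theorem symm_mem_source (L : HilbertLamination k X H P) (i : ι) (p : H i × P i) :
    (L.chart i).symm p ∈ (L.chart i).source :=
  (L.chart i).map_target (by rw [L.target_eq]; trivial)

theorem chart_symm (L : HilbertLamination k X H P) (i : ι) (p : H i × P i) :
    L.chart i ((L.chart i).symm p) = p :=
  (L.chart i).right_inv (by rw [L.target_eq]; trivial)

theorem continuous_symm (L : HilbertLamination k X H P) (i : ι) :
    Continuous (L.chart i).symm := by
  rw [← continuousOn_univ, ← L.target_eq i]
  exact (L.chart i).continuousOn_symm

theorem mem_trans_source (L : HilbertLamination k X H P) {i j : ι} {p : H i × P i} :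
    p ∈ ((L.chart i).symm.trans (L.chart j)).source ↔
      (L.chart i).symm p ∈ (L.chart j).source := by
  simp [L.target_eq]

/-- A change of coordinates has the form `(x, s) ↦ (f (x, s), g s)` on an open neighbourhood of
each point of its domain. -/
theorem exists_isOpen_transverse (L : HilbertLamination k X H P) {i j : ι} {p : H i × P i}
    (hp : (L.chart i).symm p ∈ (L.chart j).source) :
    ∃ W, IsOpen W ∧ p ∈ W ∧ (∀ q ∈ W, (L.chart i).symm q ∈ (L.chart j).source) ∧
      LeafwiseContDiffOn k (fun q : H i × P i => (L.chart j ((L.chart i).symm q)).1) W ∧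
      ContinuousOn (fun q : H i × P i => L.chart j ((L.chart i).symm q)) W ∧
      ∃ g : P i → P j, ∀ q ∈ W, (L.chart j ((L.chart i).symm q)).2 = g q.2 := by
  obtain ⟨N, hN, g, hg⟩ := L.transverse i j p (L.mem_trans_source.2 hp)
  obtain ⟨N', hN'N, hN', hpN'⟩ := mem_nhds_iff.1 hN
  refine ⟨((L.chart i).symm.trans (L.chart j)).source ∩ N',
    ((L.chart i).symm.trans (L.chart j)).open_source.inter hN',
    ⟨L.mem_trans_source.2 hp, hpN'⟩, fun q hq => L.mem_trans_source.1 hq.1,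
    (L.leafwise_contDiffOn i j).mono inter_subset_left, ?_, g, fun q hq => hg q (hN'N hq.2)⟩
  exact ((L.chart i).symm.trans (L.chart j)).continuousOn.mono inter_subset_left

theorem isContDiff_iff {f : X → F} : L.IsContDiff r f ↔ ∀ x, L.IsContDiffAt r f x := by
  refine ⟨fun h x i _ => ⟨univ, isOpen_univ, mem_univ _, h i⟩, fun h i => ?_⟩
  refine LeafwiseContDiffOn.of_forall_mem fun p _ => ?_
  obtain ⟨U, hU, hp, hf⟩ := h _ i (L.symm_mem_source i p)
  exact ⟨U, hU, by rwa [L.chart_symm] at hp, hf⟩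

namespace IsContDiffAt

variable {f f' : X → F} {x : X}

/-- It suffices to check that a map is of class `C^r` in one foliated chart. -/
theorem of_chart (hr : r ≤ k) {i : ι} (hx : x ∈ (L.chart i).source)
    {U : Set (H i × P i)} (hU : IsOpen U) (hxU : L.chart i x ∈ U)
    (hf : LeafwiseContDiffOn r (fun p : H i × P i => f ((L.chart i).symm p)) U) :
    L.IsContDiffAt r f x := by
  intro j hj
  have hsymm : (L.chart j).symm (L.chart j x) = x := (L.chart j).left_inv hj
  obtain ⟨W, hW, hpW, hWs, hWl, hWc, g, hg⟩ :=
    L.exists_isOpen_transverse (i := j) (j := i) (p := L.chart j x) (by rwa [hsymm])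
  have hW' := hWc.isOpen_inter_preimage hW hU
  refine ⟨_, hW', ⟨hpW, ?_⟩, ?_⟩
  · simpa [hsymm] using hxU
  · have := hf.comp hU hW' ((hWl.of_le hr).mono inter_subset_left) (hWc.mono inter_subset_left)
      (fun p hp => hg p hp.1) fun p hp => hp.2
    refine this.congr hW' fun p hp => ?_
    show f _ = f _
    rw [(L.chart i).left_inv (hWs p hp.1)]

theorem of_le (hf : L.IsContDiffAt k f x) (h : r ≤ k) : L.IsContDiffAt r f x := fun i hi =>
  let ⟨U, hU, hx, hfU⟩ := hf i hi
  ⟨U, hU, hx, hfU.of_le h⟩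

theorem congr (hf : L.IsContDiffAt r f x) (h : f' =ᶠ[𝓝 x] f) : L.IsContDiffAt r f' x := by
  intro i hi
  obtain ⟨U, hU, hx, hfU⟩ := hf i hi
  obtain ⟨N, hN, hNo, hxN⟩ := eventually_nhds_iff.1 h
  have ho := hU.inter (hNo.preimage (L.continuous_symm i))
  refine ⟨_, ho, ⟨hx, ?_⟩, (hfU.mono inter_subset_left).congr ho fun p hp => hN _ hp.2⟩
  simpa [(L.chart i).left_inv hi] using hxN

theorem const (c : F) : L.IsContDiffAt r (fun _ => c) x := fun _ _ =>
  ⟨univ, isOpen_univ, mem_univ _, LeafwiseContDiffOn.comp_fst contDiff_const⟩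

theorem continuousAt (hf : L.IsContDiffAt r f x) : ContinuousAt f x := by
  obtain ⟨i, hi⟩ := L.cover x
  obtain ⟨U, hU, hx, hfU⟩ := hf i hi
  have h := ContinuousAt.comp (f := L.chart i) (hfU.continuousOn.continuousAt (hU.mem_nhds hx))
    ((L.chart i).continuousAt hi)
  refine h.congr ?_
  filter_upwards [(L.chart i).open_source.mem_nhds hi] with z hz
  simp [(L.chart i).left_inv hz]

theorem contDiffOn_comp {O : Set F} {h : F → G} (hh : ContDiffOn ℝ r h O) (hO : IsOpen O)
    (hf : L.IsContDiffAt r f x) (hx : f x ∈ O) : L.IsContDiffAt r (fun z => h (f z)) x := by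
  intro i hi
  obtain ⟨U, hU, hxU, hfU⟩ := hf i hi
  have ho := hfU.continuousOn.isOpen_inter_preimage hU hO
  refine ⟨_, ho, ⟨hxU, ?_⟩,
    LeafwiseContDiffOn.contDiffOn_comp hh hO (hfU.mono inter_subset_left) ho fun p hp => hp.2⟩
  simpa [(L.chart i).left_inv hi] using hx

theorem contDiff_comp {h : F → G} (hh : ContDiff ℝ r h) (hf : L.IsContDiffAt r f x) :
    L.IsContDiffAt r (fun z => h (f z)) x :=
  contDiffOn_comp hh.contDiffOn isOpen_univ hf (mem_univ _)

theorem prodMk {f' : X → G} (hf : L.IsContDiffAt r f x) (hf' : L.IsContDiffAt r f' x) :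
    L.IsContDiffAt r (fun z => (f z, f' z)) x := by
  intro i hi
  obtain ⟨U, hU, hxU, hfU⟩ := hf i hi
  obtain ⟨U', hU', hxU', hfU'⟩ := hf' i hi
  exact ⟨U ∩ U', hU.inter hU', ⟨hxU, hxU'⟩,
    (hfU.mono inter_subset_left).prodMk (hfU'.mono inter_subset_right) (hU.inter hU')⟩

theorem add (hf : L.IsContDiffAt r f x) (hf' : L.IsContDiffAt r f' x) :
    L.IsContDiffAt r (fun z => f z + f' z) x :=
  contDiff_comp (h := fun p : F × F => p.1 + p.2) (by fun_prop) (hf.prodMk hf')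

theorem smul {a : X → ℝ} (ha : L.IsContDiffAt r a x) (hf : L.IsContDiffAt r f x) :
    L.IsContDiffAt r (fun z => a z • f z) x :=
  contDiff_comp (h := fun p : ℝ × F => p.1 • p.2) (by fun_prop) (ha.prodMk hf)

theorem sum {α : Type*} (s : Finset α) {f : α → X → F} (hf : ∀ n, L.IsContDiffAt r (f n) x) :
    L.IsContDiffAt r (fun z => ∑ n ∈ s, f n z) x := by
  classical
  induction s using Finset.induction_on with
  | empty => simpa using const 0
  | insert a s ha ih => simpa [Finset.sum_insert ha] using (hf a).add ih

theorem prod {α : Type*} (s : Finset α) {f : α → X → ℝ} (hf : ∀ n, L.IsContDiffAt r (f n) x) :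
    L.IsContDiffAt r (fun z => ∏ n ∈ s, f n z) x := by
  classical
  induction s using Finset.induction_on with
  | empty => simpa using const 1
  | insert a s ha ih => simpa [Finset.prod_insert ha] using (hf a).smul ih

theorem finsum {f : ℕ → X → F} (hf : ∀ n, L.IsContDiffAt r (f n) x) {N : ℕ}
    (hN : ∀ᶠ z in 𝓝 x, ∀ n ≥ N, f n z = 0) : L.IsContDiffAt r (fun z => ∑ᶠ n, f n z) x := by
  refine (sum (Finset.range N) hf).congr ?_
  filter_upwards [hN] with z hz
  refine finsum_eq_sum_of_support_subset _ fun n hn => ?_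
  by_contra hnN
  exact hn (hz n (by simpa using hnN))

/-- The product with a function whose closed support avoids `x` is locally zero. -/
theorem smul_of_tsupport {a : X → ℝ} (ha : L.IsContDiffAt r a x)
    (hf : x ∈ tsupport a → L.IsContDiffAt r f x) :
    L.IsContDiffAt r (fun z => a z • f z) x := by
  by_cases hx : x ∈ tsupport a
  · exact ha.smul (hf hx)
  · refine (const 0).congr ?_
    filter_upwards [notMem_tsupport_iff_eventuallyEq.1 hx] with z hz
    simp [hz]

/-- A function of class `C^k` of the leaf coordinate of a chart is of class `C^k`. -/
theorem comp_chart_fst {i : ι} (hx : x ∈ (L.chart i).source) {a : H i → F}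
    (ha : ContDiff ℝ k a) : L.IsContDiffAt k (fun z => a (L.chart i z).1) x :=
  of_chart le_rfl hx isOpen_univ (mem_univ _) <| by
    simpa only [L.chart_symm] using LeafwiseContDiffOn.comp_fst ha

/-- A continuous function of the transverse coordinate of a chart is of class `C^k`. -/
theorem comp_chart_snd {i : ι} (hx : x ∈ (L.chart i).source) {b : P i → F}
    (hb : Continuous b) : L.IsContDiffAt k (fun z => b (L.chart i z).2) x :=
  of_chart le_rfl hx isOpen_univ (mem_univ _) <| by
    simpa only [L.chart_symm] using LeafwiseContDiffOn.comp_snd hb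

end IsContDiffAt

theorem IsContDiff.continuous {f : X → F} (hf : L.IsContDiff r f) : Continuous f :=
  continuous_iff_continuousAt.2 fun x => (isContDiff_iff.1 hf x).continuousAt

end Calculus

section Partition

variable {k : ℕ∞} {X : Type*} [TopologicalSpace X] {ι : Type*} {H P : ι → Type*}
  [∀ i, NormedAddCommGroup (H i)] [∀ i, InnerProductSpace ℝ (H i)] [∀ i, TopologicalSpace (P i)]

/-- Bump functions of class `C^k`: the product of a smooth bump function of the leaf coordinate and
a Urysohn function of the transverse one, extended by zero. As balls of a chart need not be closed
in `X`, the support is controlled by a closed neighbourhood of `x` in the domain of the chart. -/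
theorem exists_bump [RegularSpace X] [∀ i, T4Space (P i)] (L : HilbertLamination k X H P)
    {x : X} {V : Set X} (hV : V ∈ 𝓝 x) :
    ∃ l : X → ℝ, L.IsContDiff k l ∧ (∀ z, 0 ≤ l z) ∧ 0 < l x ∧ tsupport l ⊆ V := by
  classical
  obtain ⟨i, hi⟩ := L.cover x
  obtain ⟨C, hC, hCc, hCV⟩ := exists_mem_nhds_isClosed_subset
    (Filter.inter_mem hV ((L.chart i).open_source.mem_nhds hi))
  have hp : (L.chart i).symm ⁻¹' C ∈ 𝓝 (L.chart i x) :=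
    (L.continuous_symm i).continuousAt.preimage_mem_nhds (by rwa [(L.chart i).left_inv hi])
  obtain ⟨A, hA, B, hB, hAB⟩ := mem_nhds_prod_iff.1 hp
  obtain ⟨ε, hε, hεA⟩ := Metric.mem_nhds_iff.1 hA
  let a : ContDiffBump (L.chart i x).1 := ⟨ε / 2, ε, half_pos hε, half_lt_self hε⟩
  obtain ⟨b, hb0, hb1, hb⟩ := exists_continuous_zero_one_of_isClosed
    (s := (interior B)ᶜ) (t := {(L.chart i x).2}) isOpen_interior.isClosed_compl isClosed_singleton
    (by
      rw [disjoint_singleton_right, mem_compl_iff, not_not]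
      exact mem_interior_iff_mem_nhds.2 hB)
  let l : X → ℝ := (L.chart i).source.indicator
    fun z => a (L.chart i z).1 * b (L.chart i z).2
  have hsupp : ∀ z, l z ≠ 0 → z ∈ C := by
    intro z hz
    have hzi : z ∈ (L.chart i).source := mem_of_indicator_ne_zero hz
    simp only [l, indicator_of_mem hzi, mul_ne_zero_iff] at hz
    have h1 : (L.chart i z).1 ∈ A := by
      apply hεA
      have := a.support_eq ▸ Function.mem_support.2 hz.1
      exact this
    have h2 : (L.chart i z).2 ∈ B := by
      by_contra h
      exact hz.2 (hb0 fun h' => h (interior_subset h'))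
    have := hAB (mk_mem_prod h1 h2)
    simpa [(L.chart i).left_inv hzi] using this
  have htsupp : tsupport l ⊆ C := closure_minimal hsupp hCc
  refine ⟨l, isContDiff_iff.2 fun z => ?_, fun z => ?_, ?_, fun z hz => (hCV (htsupp hz)).1⟩
  · by_cases hz : z ∈ tsupport l
    · have hzi := (hCV (htsupp hz)).2
      refine ((IsContDiffAt.comp_chart_fst hzi a.contDiff).smul
        (IsContDiffAt.comp_chart_snd hzi b.continuous)).congr ?_
      filter_upwards [(L.chart i).open_source.mem_nhds hzi] with y hy
      simp [l, hy]
    · exact (IsContDiffAt.const 0).congr (notMem_tsupport_iff_eventuallyEq.1 hz)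
  · exact indicator_nonneg (fun y _ => mul_nonneg a.nonneg (hb _).1) z
  · have h1 : b (L.chart i x).2 = 1 := hb1 rfl
    simp [l, hi, h1, a.pos_of_mem_ball (Metric.mem_ball_self a.rOut_pos)]

/-- Countable, locally finite partitions of unity of class `C^k`, normalized so that the sum of the
squares is `1`: then `m ↦ μ m x` is a unit vector of `ℓ²`. -/
theorem exists_partition [SecondCountableTopology X] [RegularSpace X] [∀ i, T4Space (P i)]
    [Nonempty X] (L : HilbertLamination k X H P) {V : X → Set X} (hV : ∀ x, V x ∈ 𝓝 x) :
    ∃ (c : ℕ → X) (μ : ℕ → X → ℝ), (∀ n, L.IsContDiff k (μ n)) ∧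
      (∀ n, tsupport (μ n) ⊆ V (c n)) ∧ (∀ x, ∃ N, ∀ᶠ z in 𝓝 x, ∀ n ≥ N, μ n z = 0) ∧
      ∀ x, ∑ᶠ n, μ n x ^ 2 = 1 := by
  choose l hl hl0 hlx hlV using fun x => L.exists_bump (hV x)
  obtain ⟨s, hs, hsu⟩ := TopologicalSpace.countable_cover_nhds (f := fun x => {z | 0 < l x z})
    fun x => (hl x).continuous.continuousAt.eventually (lt_mem_nhds (hlx x))
  have hsne : s.Nonempty := by
    by_contra h
    rw [not_nonempty_iff_eq_empty] at h
    simp only [h, mem_empty_iff_false, iUnion_of_empty, iUnion_empty] at hsu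
    exact empty_ne_univ hsu
  obtain ⟨c, rfl⟩ := hs.exists_eq_range hsne
  have hcov : ∀ x, ∃ n, 0 < l (c n) x := by
    intro x
    have : x ∈ ⋃ y ∈ range c, {z | 0 < l y z} := hsu ▸ mem_univ x
    simpa using this
  -- Damping by the earlier functions: `ν n` vanishes where `l (c m) ≥ 1 / n` for some `m < n`.
  let ν : ℕ → X → ℝ := fun n x =>
    l (c n) x • ∏ m ∈ Finset.range n, Real.smoothTransition (1 - n * l (c m) x)
  have hν : ∀ n x, L.IsContDiffAt k (ν n) x := fun n x =>
    (isContDiff_iff.1 (hl (c n)) x).smul <| IsContDiffAt.prod _ fun m =>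
      IsContDiffAt.contDiff_comp (h := fun t : ℝ => Real.smoothTransition (1 - n * t))
        (Real.smoothTransition.contDiff.comp (by fun_prop)) (isContDiff_iff.1 (hl (c m)) x)
  have hfin : ∀ x, ∃ N, ∀ᶠ z in 𝓝 x, ∀ n ≥ N, ν n z = 0 := by
    intro x
    obtain ⟨m, hm⟩ := hcov x
    obtain ⟨M, hM⟩ := exists_nat_ge (1 / (l (c m) x / 2))
    refine ⟨max M (m + 1), ?_⟩
    filter_upwards [(hl (c m)).continuous.continuousAt.eventually
      (lt_mem_nhds (half_lt_self hm))] with z hz n hn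
    simp only [ν, smul_eq_mul, mul_eq_zero, Finset.prod_eq_zero_iff]
    refine Or.inr ⟨m, by simp; omega, Real.smoothTransition.zero_of_nonpos ?_⟩
    have hMn : (M : ℝ) ≤ n := by exact_mod_cast (le_max_left _ _).trans hn
    rw [div_le_iff₀ (half_pos hm)] at hM
    have : (M : ℝ) * (l (c m) x / 2) ≤ n * l (c m) z := by gcongr
    linarith
  have hpos : ∀ x, 0 < ∑ᶠ n, ν n x ^ 2 := by
    intro x
    obtain ⟨N, hN⟩ := hfin x
    classical
    let n := Nat.find (hcov x)
    have hn : 0 < l (c n) x := Nat.find_spec (hcov x)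
    have hm : ∀ m < n, l (c m) x = 0 := fun m hm =>
      le_antisymm (not_lt.1 (Nat.find_min (hcov x) hm)) (hl0 _ _)
    have hνn : 0 < ν n x := by
      have : ∏ m ∈ Finset.range n, Real.smoothTransition (1 - n * l (c m) x) = 1 :=
        Finset.prod_eq_one fun m hmn => by simp [hm m (Finset.mem_range.1 hmn)]
      simpa [ν, this] using hn
    refine finsum_pos (fun i => sq_nonneg _) ⟨n, by positivity⟩ ?_
    refine (finite_lt_nat N).subset fun i hi => ?_
    by_contra hiN
    exact hi (by simp [hN.self_of_nhds i (not_lt.1 hiN)])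
  let S : X → ℝ := fun x => ∑ᶠ n, ν n x ^ 2
  have hS : ∀ x, L.IsContDiffAt k S x := by
    intro x
    obtain ⟨N, hN⟩ := hfin x
    refine IsContDiffAt.finsum (N := N) (fun n => ?_) ?_
    · exact IsContDiffAt.contDiff_comp (h := fun t : ℝ => t ^ 2) (by fun_prop) (hν n x)
    · filter_upwards [hN] with z hz n hn
      simp [hz n hn]
  refine ⟨c, fun n x => ν n x • (√(S x))⁻¹, fun n => isContDiff_iff.2 fun x => (hν n x).smul ?_,
    fun n => ?_, fun x => ?_, fun x => ?_⟩
  · refine IsContDiffAt.contDiffOn_comp (h := fun t : ℝ => (√t)⁻¹) (O := Ioi 0) ?_ isOpen_Ioi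
      (hS x) (hpos x)
    intro t ht
    have ht' : t ≠ 0 := ne_of_gt ht
    exact ((Real.contDiffAt_sqrt ht').inv (Real.sqrt_pos.2 ht).ne').contDiffWithinAt
  · refine (closure_mono fun x hx => ?_).trans (hlV (c n))
    intro h
    exact hx (by simp [ν, h])
  · obtain ⟨N, hN⟩ := hfin x
    refine ⟨N, ?_⟩
    filter_upwards [hN] with z hz n hn
    simp [hz n hn]
  · have h2 : (√(S x))⁻¹ ^ 2 = (S x)⁻¹ := by rw [inv_pow, Real.sq_sqrt (hpos x).le]
    simp only [smul_eq_mul, mul_pow, h2]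
    rw [← finsum_mul']
    · exact mul_inv_cancel₀ (hpos x).ne'
    · obtain ⟨N, hN⟩ := hfin x
      refine (finite_lt_nat N).subset fun i hi => ?_
      by_contra hiN
      exact hi (by simp [hN.self_of_nhds i (not_lt.1 hiN)])

end Partition

end HilbertLamination

/-! ### Closed embeddings in the sequence space -/

section SequenceSpace

/-- The isometric embedding `ℓ²(α) → ℓ²(ℕ)` which relabels the coordinates along an injection
`e : α → ℕ` and fills in zeros. -/
noncomputable def l2Relabel {α : Type*} {e : α → ℕ} (he : Function.Injective e) :
    ℓ²(α, ℝ) →ₗᵢ[ℝ] ℓ²(ℕ, ℝ) :=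
  ((HilbertBasis.ofRepr (LinearIsometryEquiv.refl ℝ ℓ²(ℕ, ℝ))).orthonormal.comp e
    he).orthogonalFamily.linearIsometry

theorem inner_l2Relabel {α β : Type*} {e : α → ℕ} (he : Function.Injective e) {e' : β → ℕ}
    (he' : Function.Injective e') (h : ∀ a b, e a ≠ e' b) (x : ℓ²(α, ℝ)) (y : ℓ²(β, ℝ)) :
    inner ℝ (l2Relabel he x) (l2Relabel he' y) = 0 := by
  set b : HilbertBasis ℕ ℝ ℓ²(ℕ, ℝ) := HilbertBasis.ofRepr (LinearIsometryEquiv.refl ℝ ℓ²(ℕ, ℝ))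
  have hx := (b.orthonormal.comp e he).orthogonalFamily.hasSum_linearIsometry x
  have hy := (b.orthonormal.comp e' he').orthogonalFamily.hasSum_linearIsometry y
  have h1 : ∀ a, inner ℝ (b (e a)) (l2Relabel he' y) = 0 := fun a => by
    refine (hy.mapL (innerSL ℝ (b (e a)))).unique ?_
    have h0 : ∀ j, inner ℝ (b (e a)) (b (e' j)) = 0 := fun j => b.orthonormal.2 (h a j)
    simp [h0, hasSum_zero]
  have h2 : inner ℝ (l2Relabel he' y) (l2Relabel he x) = 0 := by
    refine (hx.mapL (innerSL ℝ (l2Relabel he' y))).unique ?_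
    have h0 : ∀ a, inner ℝ (l2Relabel he' y) (b (e a)) = 0 := fun a =>
      (real_inner_comm _ _).trans (h1 a)
    simp [h0, hasSum_zero]
  rw [real_inner_comm, h2]

/-- `ℓ²` contains a sequence of pairwise orthogonal isometric copies of itself; `π m` is the
orthogonal projection to the `m`-th one. -/
theorem exists_orthogonal_copies : ∃ (V : ℕ → ℓ²(ℕ, ℝ) →ₗᵢ[ℝ] ℓ²(ℕ, ℝ))
    (π : ℕ → ℓ²(ℕ, ℝ) →L[ℝ] ℓ²(ℕ, ℝ)),
    (∀ m y, π m (V m y) = y) ∧ ∀ m n, m ≠ n → ∀ y, π m (V n y) = 0 := by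
  have he : ∀ m, Function.Injective (Nat.pair m) := fun m a b hab => by
    simpa using hab
  refine ⟨fun m => l2Relabel (he m),
    fun m => ContinuousLinearMap.adjoint (l2Relabel (he m)).toContinuousLinearMap, fun m y => ?_,
    fun m n hmn y => ?_⟩
  · exact congrArg (fun A : ℓ²(ℕ, ℝ) →L[ℝ] ℓ²(ℕ, ℝ) => A y)
      (l2Relabel (he m)).adjoint_comp_self
  · refine ext_inner_right ℝ fun z => ?_
    rw [ContinuousLinearMap.adjoint_inner_left, inner_zero_left]
    exact inner_l2Relabel (he n) (he m)
      (fun a b hab => hmn (by simpa using hab.symm : m = n ∧ _).1) y z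

theorem Orthonormal.countable {H : Type*} [NormedAddCommGroup H] [InnerProductSpace ℝ H]
    [TopologicalSpace.SeparableSpace H] {α : Type*} {v : α → H} (hv : Orthonormal ℝ v) :
    Countable α := by
  refine Pairwise.countable_of_isOpen_disjoint (s := fun a => Metric.ball (v a) (1 / 2)) ?_
    (fun _ => Metric.isOpen_ball) fun a => ⟨v a, Metric.mem_ball_self (by norm_num)⟩
  intro a b hab
  refine Metric.ball_disjoint_ball ?_
  have h : ‖v a - v b‖ ^ 2 = 2 := by
    rw [norm_sub_sq_real, hv.1, hv.1, hv.2 hab]; norm_num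
  rw [dist_eq_norm]
  nlinarith [norm_nonneg (v a - v b)]

/-- A separable Hilbert space embeds isometrically in `ℓ²`, with a continuous linear retraction. -/
theorem exists_isometry_l2 (H : Type*) [NormedAddCommGroup H] [InnerProductSpace ℝ H]
    [CompleteSpace H] [TopologicalSpace.SeparableSpace H] :
    ∃ (J : H →L[ℝ] ℓ²(ℕ, ℝ)) (K : ℓ²(ℕ, ℝ) →L[ℝ] H), ∀ x, K (J x) = x := by
  obtain ⟨w, b, -⟩ := exists_hilbertBasis ℝ H
  have := b.orthonormal.countable
  obtain ⟨e, he⟩ := exists_injective_nat w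
  let J := (l2Relabel he).comp b.repr.toLinearIsometry
  exact ⟨J.toContinuousLinearMap, ContinuousLinearMap.adjoint J.toContinuousLinearMap, fun x =>
    congrArg (fun A : H →L[ℝ] H => A x) J.adjoint_comp_self⟩

/-- A continuous map is a closed embedding as soon as every filter along which it converges has a
limit. Injectivity is the case of filters generated by two points, properness that of
ultrafilters. -/
theorem Topology.IsClosedEmbedding.of_filter {X Y : Type*} [TopologicalSpace X] [T1Space X]
    [TopologicalSpace Y] [T2Space Y] {f : X → Y} (hf : Continuous f)
    (h : ∀ (l : Filter X) [l.NeBot] (y : Y), Filter.Tendsto f l (𝓝 y) → ∃ x, l ≤ 𝓝 x) :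
    IsClosedEmbedding f := by
  refine .of_continuous_injective_isClosedMap hf (fun p q hpq => ?_) (IsProperMap.isClosedMap ?_)
  · obtain ⟨x, hx⟩ := h (pure p ⊔ pure q) (f p) <| by
      refine Filter.Tendsto.sup ?_ ?_
      · exact tendsto_pure_nhds f p
      · exact hpq ▸ tendsto_pure_nhds f q
    rw [sup_le_iff, pure_le_nhds_iff, pure_le_nhds_iff] at hx
    rw [hx.1, hx.2]
  · refine isProperMap_iff_ultrafilter.2 ⟨hf, fun u y hu => ?_⟩
    obtain ⟨x, hx⟩ := h u y hu
    exact ⟨x, tendsto_nhds_unique ((hf.tendsto x).mono_left hx) hu, hx⟩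

theorem Topology.IsClosedEmbedding.exists_le_nhds {X Y : Type*} [TopologicalSpace X]
    [TopologicalSpace Y] {f : X → Y} (hf : IsClosedEmbedding f) {l : Filter X} [l.NeBot] {y : Y}
    (hy : Filter.Tendsto f l (𝓝 y)) : ∃ x, l ≤ 𝓝 x := by
  obtain ⟨x, rfl⟩ := hf.isClosed_range.mem_of_tendsto hy (.of_forall fun x => mem_range_self x)
  exact ⟨x, hf.isInducing.nhds_eq_comap x ▸ hy.le_comap⟩

end SequenceSpace

namespace HilbertLamination

variable {k : ℕ∞} {X : Type*} [TopologicalSpace X] {ι : Type*} {H P : ι → Type*}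
  [∀ i, NormedAddCommGroup (H i)] [∀ i, InnerProductSpace ℝ (H i)] [∀ i, TopologicalSpace (P i)]

/-- Partitions of unity as maps of class `C^k` to the unit sphere of `ℓ²`. -/
theorem exists_unit_partition [SecondCountableTopology X] [RegularSpace X] [∀ i, T4Space (P i)]
    [Nonempty X] (L : HilbertLamination k X H P) {V : X → Set X} (hV : ∀ x, V x ∈ 𝓝 x) :
    ∃ (c : ℕ → X) (ψ : X → ℓ²(ℕ, ℝ)), L.IsContDiff k ψ ∧ (∀ x, ‖ψ x‖ = 1) ∧
      (∀ n, tsupport (fun x => ψ x n) ⊆ V (c n)) ∧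
      (∀ x, ∃ N, ∀ᶠ z in 𝓝 x, ∀ n ≥ N, ψ z n = 0) ∧ ∀ x, ∑ᶠ n, ψ x n ^ 2 = 1 := by
  obtain ⟨c, μ, hμ, hμV, hfin, hsum⟩ := L.exists_partition hV
  have hsupp : ∀ x, ∃ N, ∀ n ≥ N, μ n x = 0 := fun x =>
    (hfin x).imp fun N hN => hN.self_of_nhds
  let ψ : X → ℓ²(ℕ, ℝ) := fun x => ∑ᶠ n, μ n x • lp.single 2 n (1 : ℝ)
  have hψ : ∀ {x N}, (∀ n ≥ N, μ n x = 0) →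
      ψ x = ∑ n ∈ Finset.range N, lp.single 2 n (μ n x) := by
    intro x N hN
    have : ψ x = ∑ n ∈ Finset.range N, μ n x • lp.single 2 n (1 : ℝ) := by
      refine finsum_eq_sum_of_support_subset _ fun n hn => ?_
      by_contra hnN
      exact hn (by simp [hN n (by simpa using hnN)])
    rw [this]
    refine Finset.sum_congr rfl fun n _ => ?_
    rw [← lp.single_smul, smul_eq_mul, mul_one]
  have hcoord : ∀ x n, ψ x n = μ n x := by
    intro x n
    obtain ⟨N, hN⟩ := hsupp x
    rw [hψ hN, lp.coeFn_sum, Finset.sum_apply]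
    simp only [lp.single_apply, Pi.single_apply, Finset.sum_ite_eq, Finset.mem_range]
    split_ifs with h
    · rfl
    · exact (hN n (not_lt.1 h)).symm
  refine ⟨c, ψ, isContDiff_iff.2 fun x => ?_, fun x => ?_, fun n => ?_, fun x => ?_, fun x => ?_⟩
  · obtain ⟨N, hN⟩ := hfin x
    refine IsContDiffAt.finsum (N := N)
      (fun n => (isContDiff_iff.1 (hμ n) x).smul (IsContDiffAt.const _)) ?_
    filter_upwards [hN] with z hz n hn
    simp [hz n hn]
  · obtain ⟨N, hN⟩ := hsupp x
    have h := lp.norm_sum_single (p := 2) (by norm_num) (fun n => μ n x) (Finset.range N)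
    rw [← hψ hN] at h
    simp only [ENNReal.toReal_ofNat, Real.rpow_ofNat, Real.norm_eq_abs, sq_abs] at h
    have h2 : ∑ n ∈ Finset.range N, μ n x ^ 2 = 1 := by
      rw [← hsum x]
      refine (finsum_eq_sum_of_support_subset _ fun n hn => ?_).symm
      by_contra hnN
      exact hn (by simp [hN n (by simpa using hnN)])
    rw [h2] at h
    exact (pow_eq_one_iff_of_nonneg (norm_nonneg _) two_ne_zero).1 h
  · simpa only [hcoord] using hμV n
  · simpa only [hcoord] using hfin x
  · simpa only [hcoord] using hsum x

/-- A topological space as a lamination whose leaves are its points. -/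
noncomputable def pointLeaves (Q : Type*) [TopologicalSpace Q] :
    HilbertLamination 0 Q (fun _ : Unit => EuclideanSpace ℝ (Fin 0)) (fun _ : Unit => Q) where
  chart _ := (Homeomorph.uniqueProd (EuclideanSpace ℝ (Fin 0)) Q).symm.toOpenPartialHomeomorph
  target_eq _ := rfl
  cover _ := ⟨(), trivial⟩
  leafwise_contDiffOn _ _ :=
    (LeafwiseContDiffOn.comp_fst (a := fun _ => 0) contDiff_const).congr
      (OpenPartialHomeomorph.open_source _) fun _ _ => Subsingleton.elim _ _
  transverse _ _ _ _ := ⟨univ, Filter.univ_mem, id, fun _ _ => rfl⟩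

end HilbertLamination

/-- If a unit-vector valued map converges along a filter, then one of its coordinates converges to
a nonzero number. -/
theorem exists_coord_tendsto_ne_zero {X : Type*} {l : Filter X} [l.NeBot] {ψ : X → ℓ²(ℕ, ℝ)}
    (h1 : ∀ x, ‖ψ x‖ = 1) {y : ℓ²(ℕ, ℝ)} (hy : Filter.Tendsto ψ l (𝓝 y)) :
    ∃ n, ∃ a : ℝ, a ≠ 0 ∧ Filter.Tendsto (fun x => ψ x n) l (𝓝 a) := by
  have hy1 : ‖y‖ = 1 := tendsto_nhds_unique hy.norm (by simp [h1])
  by_contra! hc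
  have : y = 0 := by
    ext n
    by_contra hn
    exact hc n (y n) hn (((lp.evalCLM ℝ (fun _ : ℕ => ℝ) 2 n).continuous.tendsto y).comp hy)
  simp [this] at hy1

/-- Every Polish space embeds in `ℓ²` as a closed subspace. The embedding combines partitions of
unity of mesh `2 ^ (-j)`, each read as a map to the unit sphere: along a filter, convergence of the
`j`-th one forces the filter to concentrate on a ball of radius `2 ^ (-j)`. -/
theorem PolishSpace.exists_isClosedEmbedding_l2 (Q : Type*) [TopologicalSpace Q] [PolishSpace Q] :
    ∃ θ : Q → ℓ²(ℕ, ℝ), IsClosedEmbedding θ := by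
  rcases isEmpty_or_nonempty Q with hQ | hQ
  · exact ⟨fun _ => 0, .of_filter (continuous_of_const fun _ _ => rfl) fun l _ _ _ =>
      (Filter.neBot_iff.1 ‹_› (Subsingleton.elim _ _)).elim⟩
  let _ := TopologicalSpace.upgradeIsCompletelyMetrizable Q
  choose c ψ hψ hψ1 hψV hψfin hψsum using fun j : ℕ =>
    (HilbertLamination.pointLeaves Q).exists_unit_partition
      (V := fun x => Metric.ball x ((1 / 2) ^ j)) fun x => Metric.ball_mem_nhds x (by positivity)
  obtain ⟨V, π, hπV, hπV'⟩ := exists_orthogonal_copies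
  let f : ℕ → Q → ℓ²(ℕ, ℝ) := fun j x => V j (((1 / 2 : ℝ) ^ j) • ψ j x)
  have hbound : ∀ j x, ‖f j x‖ ≤ (1 / 2 : ℝ) ^ j := fun j x => by
    simp [f, norm_smul, hψ1]
  have hgeom : Summable fun j : ℕ => (1 / 2 : ℝ) ^ j := summable_geometric_two
  have hsum : ∀ x, Summable fun j => f j x := fun x =>
    Summable.of_norm_bounded hgeom fun j => hbound j x
  have hcψ : ∀ j, Continuous fun x => (1 / 2 : ℝ) ^ j • ψ j x := fun j => by
    have := (hψ j).continuous
    fun_prop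
  have hcont : Continuous fun x => ∑' j, f j x :=
    continuous_tsum (fun j => (V j).continuous.comp (hcψ j)) hgeom hbound
  have hπ : ∀ j x, π j (∑' i, f i x) = (1 / 2 : ℝ) ^ j • ψ j x := by
    intro j x
    rw [(π j).map_tsum (hsum x), tsum_eq_single j fun i hi => hπV' j i hi.symm _]
    exact hπV j _
  refine ⟨_, .of_filter hcont fun l _ y hy => ?_⟩
  rw [← cauchy_iff_exists_le_nhds, Metric.cauchy_iff]
  refine ⟨‹_›, fun ε hε => ?_⟩
  obtain ⟨j, hj⟩ := exists_pow_lt_of_lt_one (half_pos hε) (by norm_num : (1 / 2 : ℝ) < 1)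
  have hlim : Filter.Tendsto (ψ j) l (𝓝 (((1 / 2 : ℝ) ^ j)⁻¹ • π j y)) := by
    refine ((((π j).continuous.tendsto y).comp hy).const_smul (((1 / 2 : ℝ) ^ j)⁻¹)).congr
      fun x => ?_
    rw [Function.comp_apply, hπ, inv_smul_smul₀ (by positivity)]
  obtain ⟨n, a, ha, hn⟩ := exists_coord_tendsto_ne_zero (hψ1 j) hlim
  refine ⟨{x | ψ j x n ≠ 0}, hn.eventually_ne ha, fun x hx z hz => ?_⟩
  have hx' := hψV j n (subset_tsupport _ hx)
  have hz' := hψV j n (subset_tsupport _ hz)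
  rw [Metric.mem_ball] at hx' hz'
  have := dist_triangle_right x z (c j n)
  linarith

/-! ### The closed embedding of a lamination -/

namespace HilbertLamination

variable {k : ℕ∞} {X : Type*} [TopologicalSpace X] {ι : Type*} {H P : ι → Type*}
  [∀ i, NormedAddCommGroup (H i)] [∀ i, InnerProductSpace ℝ (H i)] [∀ i, TopologicalSpace (P i)]
  (L : HilbertLamination k X H P)

/-- The leafwise differential of a map with a local left inverse that is differentiable along the
plaques has a continuous linear left inverse. -/
theorem exists_leftInverse_leafDifferential {E : Type*} [NormedAddCommGroup E] [NormedSpace ℝ E]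
    (hk : 1 ≤ k) {φ : X → E} (hφ : L.IsContDiff k φ) {i : ι} {p : H i × P i} {Ψ : E → H i}
    (hΨ : DifferentiableAt ℝ Ψ (φ ((L.chart i).symm p)))
    (hinv : ∀ᶠ x in 𝓝 p.1, Ψ (φ ((L.chart i).symm (x, p.2))) = x) :
    ∃ A : E →L[ℝ] H i, A ∘L L.leafDifferential φ i p = ContinuousLinearMap.id ℝ (H i) := by
  have hD : HasFDerivAt (fun x : H i => φ ((L.chart i).symm (x, p.2)))
      (L.leafDifferential φ i p) p.1 :=
    (((hφ i).contDiffAt isOpen_univ (mem_univ p)).differentiableAt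
      (by exact_mod_cast (zero_lt_one.trans_le hk).ne')).hasFDerivAt
  refine ⟨fderiv ℝ Ψ (φ ((L.chart i).symm p)), ?_⟩
  exact (HasFDerivAt.comp p.1 (f := fun x : H i => φ ((L.chart i).symm (x, p.2)))
    hΨ.hasFDerivAt hD).unique ((hasFDerivAt_id p.1).congr_of_eventuallyEq hinv)

/-- A lamination embeds in `ℓ²` as a closed subspace, by a map of class `C^k` whose leafwise
differentials are left invertible. With `ψ` a partition of unity subordinate to foliated charts
`z ↦ (xₙ, sₙ)`, linear embeddings `Jₙ` of the leaf directions and closed embeddings `θₙ` of the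
transversals, the map collects `ψ`, the `ψₙ • Jₙ xₙ` and the `ψₙ • θₙ sₙ`. Along a filter on
which it converges, some `ψₙ` has a nonzero limit, hence `xₙ` and `sₙ` converge. -/
theorem exists_isClosedEmbedding [SecondCountableTopology X] [T3Space X]
    [∀ i, CompleteSpace (H i)] [∀ i, TopologicalSpace.SeparableSpace (H i)]
    [∀ i, PolishSpace (P i)] (hk : 1 ≤ k) :
    ∃ φ : X → ℓ²(ℕ, ℝ), L.IsContDiff k φ ∧ IsClosedEmbedding φ ∧
      ∀ i p, ∃ A : ℓ²(ℕ, ℝ) →L[ℝ] H i,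
        A ∘L L.leafDifferential φ i p = ContinuousLinearMap.id ℝ (H i) := by
  rcases isEmpty_or_nonempty X with hX | hX
  · exact ⟨fun _ => 0, isContDiff_iff.2 fun x => isEmptyElim x,
      .of_continuous_injective_isClosedMap (continuous_of_const fun _ _ => rfl)
        (fun x => isEmptyElim x) fun s _ => by simp [Subsingleton.elim s ∅],
      fun i p => isEmptyElim ((L.chart i).symm p)⟩
  choose ic hic using L.cover
  obtain ⟨c, ψ, hψ, hψ1, hψV, hψfin, hψsum⟩ := L.exists_unit_partition
    (V := fun x => (L.chart (ic x)).source) fun x => (L.chart (ic x)).open_source.mem_nhds (hic x)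
  let a : ℕ → ι := fun n => ic (c n)
  have ha : ∀ {n z}, ψ z n ≠ 0 → z ∈ (L.chart (a n)).source := fun {n z} h =>
    hψV n (subset_tsupport (fun z => ψ z n) h)
  choose J K hK using fun n => exists_isometry_l2 (H (a n))
  choose θ hθ using fun n => PolishSpace.exists_isClosedEmbedding_l2 (P (a n))
  obtain ⟨V, π, hπV, hπV'⟩ := exists_orthogonal_copies
  have hψn : ∀ n z, L.IsContDiffAt k (fun z => ψ z n) z := fun n z =>
    IsContDiffAt.contDiff_comp (lp.evalCLM ℝ (fun _ : ℕ => ℝ) 2 n).contDiff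
      (isContDiff_iff.1 hψ z)
  let σ : (ℕ → X → ℓ²(ℕ, ℝ)) → X → ℓ²(ℕ, ℝ) := fun w z => ∑ᶠ n, V n (ψ z n • w n z)
  have hσ : ∀ {w : ℕ → X → ℓ²(ℕ, ℝ)}, (∀ n, ∀ z ∈ (L.chart (a n)).source,
      L.IsContDiffAt k (w n) z) → ∀ z, L.IsContDiffAt k (σ w) z := by
    intro w hw z
    obtain ⟨N, hN⟩ := hψfin z
    refine IsContDiffAt.finsum (N := N) (fun n => ?_) ?_
    · exact IsContDiffAt.contDiff_comp (V n).contDiff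
        ((hψn n z).smul_of_tsupport fun hz => hw n z (hψV n hz))
    · filter_upwards [hN] with y hy n hn
      simp [hy n hn]
  have hπσ : ∀ w n z, π n (σ w z) = ψ z n • w n z := by
    intro w n z
    obtain ⟨N, hN⟩ := hψfin z
    have hfin : (Function.support fun n => V n (ψ z n • w n z)).Finite := by
      refine (finite_lt_nat N).subset fun i hi => ?_
      by_contra hiN
      exact hi (by simp [hN.self_of_nhds i (not_lt.1 hiN)])
    have h := (π n).toLinearMap.toAddMonoidHom.map_finsum hfin
    have h' : ∑ᶠ m, π n (V m (ψ z m • w m z)) = ψ z n • w n z := by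
      rw [finsum_eq_single _ n fun m hm => hπV' n m hm.symm _, hπV n]
    exact h.trans h'
  -- The leaf and the transverse coordinates; outside the domain of the chart `a n` they are junk,
  -- but there `ψ · n` vanishes.
  let w₁ : ℕ → X → ℓ²(ℕ, ℝ) := fun n z => J n (L.chart (a n) z).1
  let w₂ : ℕ → X → ℓ²(ℕ, ℝ) := fun n z => θ n (L.chart (a n) z).2
  let φ : X → ℓ²(ℕ, ℝ) := fun z => V 0 (ψ z) + V 1 (σ w₁ z) + V 2 (σ w₂ z)
  have h0 : ∀ z, π 0 (φ z) = ψ z := fun z => by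
    simp [φ, hπV, hπV' 0 1, hπV' 0 2]
  have h1 : ∀ z n, π n (π 1 (φ z)) = ψ z n • J n (L.chart (a n) z).1 := fun z n => by
    simp [φ, hπV, hπV' 1 0, hπV' 1 2, hπσ, w₁]
  have h2 : ∀ z n, π n (π 2 (φ z)) = ψ z n • θ n (L.chart (a n) z).2 := fun z n => by
    simp [φ, hπV, hπV' 2 0, hπV' 2 1, hπσ, w₂]
  have hφ : L.IsContDiff k φ := isContDiff_iff.2 fun z =>
    ((IsContDiffAt.contDiff_comp (V 0).contDiff (isContDiff_iff.1 hψ z)).add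
      (IsContDiffAt.contDiff_comp (V 1).contDiff (hσ (fun n z hz =>
        IsContDiffAt.comp_chart_fst hz (J n).contDiff) z))).add
      (IsContDiffAt.contDiff_comp (V 2).contDiff (hσ (fun n z hz =>
        IsContDiffAt.comp_chart_snd hz (hθ n).continuous) z))
  refine ⟨φ, hφ, .of_filter hφ.continuous fun l _ y hy => ?_, fun i p => ?_⟩
  · have hlim : ∀ j, Filter.Tendsto (fun z => π j (φ z)) l (𝓝 (π j y)) := fun j =>
      ((π j).continuous.tendsto y).comp hy
    obtain ⟨n, b, hb, hn⟩ := exists_coord_tendsto_ne_zero hψ1 ((hlim 0).congr h0)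
    have hne : ∀ᶠ z in l, ψ z n ≠ 0 := hn.eventually_ne hb
    have hx : Filter.Tendsto (fun z => (L.chart (a n) z).1) l
        (𝓝 (K n (b⁻¹ • π n (π 1 y)))) := by
      refine (((K n).continuous.tendsto _).comp ((hn.inv₀ hb).smul
        (((π n).continuous.tendsto _).comp (hlim 1)))).congr' ?_
      filter_upwards [hne] with z hz
      simp [h1, hz, hK]
    have hs : Filter.Tendsto (fun z => θ n (L.chart (a n) z).2) l
        (𝓝 (b⁻¹ • π n (π 2 y))) := by
      refine ((hn.inv₀ hb).smul (((π n).continuous.tendsto _).comp (hlim 2))).congr' ?_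
      filter_upwards [hne] with z hz
      simp [h2, hz]
    obtain ⟨s, hs⟩ := (hθ n).exists_le_nhds (l := l.map fun z => (L.chart (a n) z).2) hs
    have hq := ((L.continuous_symm (a n)).tendsto (_, s)).comp (hx.prodMk_nhds hs)
    refine ⟨_, Filter.map_id.symm.le.trans (hq.congr' ?_)⟩
    filter_upwards [hne] with z hz
    exact (L.chart (a n)).left_inv (ha hz)
  · set z := (L.chart i).symm p with hz
    obtain ⟨n, hn⟩ : ∃ n, ψ z n ≠ 0 := by
      by_contra! h
      simpa [h] using hψsum z
    -- Along the plaque of `p` the transverse coordinate in the chart `a n` is constant.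
    let s := (L.chart (a n) z).2
    let β : ℓ²(ℕ, ℝ) → H (a n) := fun y => (π 0 y n)⁻¹ • K n (π n (π 1 y))
    have hβ : ∀ y, ψ y n ≠ 0 → β (φ y) = (L.chart (a n) y).1 := fun y hy => by
      simp [β, h0, h1, hy, hK]
    refine L.exists_leftInverse_leafDifferential hk hφ
      (Ψ := fun y => (L.chart i ((L.chart (a n)).symm (β y, s))).1) ?_ ?_
    · obtain ⟨W, hW, hqW, -, hWl, -⟩ := L.exists_isOpen_transverse (i := a n) (j := i)
        (p := L.chart (a n) z) (by
          rw [(L.chart (a n)).left_inv (ha hn)]; exact L.symm_mem_source i p)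
      have hd := (hWl.contDiffAt hW hqW).differentiableAt
        (by exact_mod_cast (zero_lt_one.trans_le hk).ne')
      rw [← hβ z hn] at hd
      have hβd : DifferentiableAt ℝ β (φ z) := by
        have he : DifferentiableAt ℝ (fun y => π 0 y n) (φ z) :=
          ((lp.evalCLM ℝ (fun _ : ℕ => ℝ) 2 n).comp (π 0)).differentiableAt
        refine (he.inv (by rwa [h0])).smul ?_
        exact ((K n).comp ((π n).comp (π 1))).differentiableAt
      exact hd.comp (φ z) hβd
    · obtain ⟨W, hW, hpW, hWs, -, -, g, hg⟩ := L.exists_isOpen_transverse (i := i) (j := a n)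
        (p := p) (ha hn)
      have hcont : Continuous fun x : H i => (L.chart i).symm (x, p.2) :=
        (L.continuous_symm i).comp (by fun_prop)
      have hne : ∀ᶠ x in 𝓝 p.1, ψ ((L.chart i).symm (x, p.2)) n ≠ 0 :=
        ContinuousAt.eventually_ne (g := fun x => ψ ((L.chart i).symm (x, p.2)) n)
          (ContinuousAt.comp (f := fun x => (L.chart i).symm (x, p.2))
            (hψn n z).continuousAt hcont.continuousAt) hn
      filter_upwards [hne, (hW.plaque p.2).mem_nhds hpW] with x hx hxW
      have hsx : s = (L.chart (a n) ((L.chart i).symm (x, p.2))).2 :=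
        (hg p hpW).trans (hg _ hxW).symm
      rw [hβ _ hx, hsx, Prod.mk.eta, (L.chart (a n)).left_inv (ha hx), L.chart_symm]

end HilbertLamination

/-! ### Extension of metric tensors -/

/-- Dugundji's extension theorem: a continuous map on a closed subspace of a metric space, with
values in a convex subset of a normed space, extends continuously with values in that convex set.
Off the subspace, the value at `y` is a convex combination of values at points which almost realize
the distance to `y`. -/
theorem Topology.IsClosedEmbedding.exists_extension_mem_convex {X Y F : Type*} [TopologicalSpace X]
    [Nonempty X] [MetricSpace Y] [NormedAddCommGroup F] [NormedSpace ℝ F] {φ : X → Y}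
    (hφ : IsClosedEmbedding φ) {f : X → F} (hf : Continuous f) {S : Set F} (hS : Convex ℝ S)
    (hfS : ∀ x, f x ∈ S) :
    ∃ g : Y → F, Continuous g ∧ (∀ x, g (φ x) = f x) ∧ ∀ y, g y ∈ S := by
  classical
  have hC := hφ.isClosed_range
  have hne : (range φ).Nonempty := range_nonempty φ
  let t : ((range φ)ᶜ : Set Y) → Set F := fun y =>
    convexHull ℝ {v | ∃ a, f a = v ∧ dist (y : Y) (φ a) < 2 * Metric.infDist (y : Y) (range φ)}
  obtain ⟨h, hh⟩ := exists_continuous_forall_mem_convex_of_local_const (t := t)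
    (fun y => convex_convexHull ℝ _) fun y => by
      have hpos : 0 < Metric.infDist (y : Y) (range φ) :=
        (hC.notMem_iff_infDist_pos hne).1 y.2
      obtain ⟨_, ⟨a, rfl⟩, ha⟩ := (Metric.infDist_lt_iff hne).1
        (lt_two_mul_self hpos)
      refine ⟨f a, ?_⟩
      have hlt : ∀ᶠ z : ((range φ)ᶜ : Set Y) in 𝓝 y,
          dist (z : Y) (φ a) < 2 * Metric.infDist (z : Y) (range φ) := by
        refine ContinuousAt.eventually_lt ?_ ?_ ha
        · fun_prop
        · exact (continuous_const.mul
            ((Metric.continuous_infDist_pt _).comp continuous_subtype_val)).continuousAt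
      filter_upwards [hlt] with z hz
      exact subset_convexHull ℝ _ ⟨a, rfl, hz⟩
  let g : Y → F := fun y => if hy : y ∈ range φ then f hy.choose else h ⟨y, hy⟩
  have hgφ : ∀ x, g (φ x) = f x := fun x => by
    have hx : φ x ∈ range φ := mem_range_self x
    simp only [g, hx, dif_pos]
    exact congrArg f (hφ.injective hx.choose_spec)
  have hgh : ∀ y (hy : y ∉ range φ), g y = h ⟨y, hy⟩ := fun y hy => by
    simp only [g, hy, dif_neg, not_false_eq_true]
  refine ⟨g, continuous_iff_continuousAt.2 fun y => ?_, hgφ, fun y => ?_⟩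
  · by_cases hy : y ∈ range φ
    · obtain ⟨a, rfl⟩ := hy
      rw [Metric.continuousAt_iff]
      intro ε hε
      have hfa : f ⁻¹' Metric.ball (f a) ε ∈ 𝓝 a :=
        hf.continuousAt.preimage_mem_nhds (Metric.ball_mem_nhds _ hε)
      rw [hφ.isInducing.nhds_eq_comap, Filter.mem_comap] at hfa
      obtain ⟨N, hN, hNf⟩ := hfa
      obtain ⟨δ, hδ, hδN⟩ := Metric.mem_nhds_iff.1 hN
      have hclose : ∀ a', dist (φ a') (φ a) < δ → f a' ∈ Metric.ball (f a) ε := fun a' ha' =>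
        hNf (hδN ha')
      refine ⟨δ / 3, by positivity, fun y hy => ?_⟩
      rw [hgφ]
      by_cases hyC : y ∈ range φ
      · obtain ⟨a', rfl⟩ := hyC
        rw [hgφ]
        exact hclose a' (hy.trans (by linarith))
      · rw [hgh y hyC]
        refine convexHull_min ?_ (convex_ball (f a) ε) (hh ⟨y, hyC⟩)
        rintro _ ⟨a', rfl, ha'⟩
        refine hclose a' ?_
        have h1 : Metric.infDist y (range φ) ≤ dist y (φ a) :=
          Metric.infDist_le_dist_of_mem (mem_range_self a)
        have h2 := dist_triangle_left (φ a') (φ a) y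
        simp only at ha'
        linarith
    · have : ContinuousOn g (range φ)ᶜ := by
        rw [continuousOn_iff_continuous_domRestrict]
        refine h.continuous.congr fun z => ?_
        exact (hgh z z.2).symm
      exact this.continuousAt (hC.isOpen_compl.mem_nhds hy)
  · by_cases hy : y ∈ range φ
    · obtain ⟨a, rfl⟩ := hy
      exact hgφ a ▸ hfS a
    · rw [hgh y hy]
      refine convexHull_min ?_ hS (hh ⟨y, hy⟩)
      rintro _ ⟨a, rfl, -⟩
      exact hfS a

section MetricExtension

-- Instances on spaces of bilinear forms need nested instance problems to be solved.
set_option maxSynthPendingDepth 3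

section InnerProducts

variable {V E : Type*} [NormedAddCommGroup V] [NormedSpace ℝ V]
  [NormedAddCommGroup E] [InnerProductSpace ℝ E]

/-- The inner product of a real Hilbert space as a continuous bilinear form. -/
noncomputable def innerForm (E : Type*) [NormedAddCommGroup E] [InnerProductSpace ℝ E] :
    E →L[ℝ] E →L[ℝ] ℝ := innerSL ℝ

theorem innerForm_apply (u v : E) : innerForm E u v = inner ℝ u v := rfl

theorem isAdmissibleInner_innerForm : IsAdmissibleInner (innerForm E) :=
  ⟨fun u v => real_inner_comm v u, 1, one_pos, fun v => by
    rw [innerForm_apply, real_inner_self_eq_norm_sq, one_mul]⟩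

theorem convex_isAdmissibleInner : Convex ℝ {b : V →L[ℝ] V →L[ℝ] ℝ | IsAdmissibleInner b} := by
  rintro b ⟨hb, c, hc, hbc⟩ b' ⟨hb', c', hc', hbc'⟩ s t hs ht hst
  refine ⟨fun u v => by simp [hb u v, hb' u v], s * c + t * c', ?_, fun v => ?_⟩
  · rcases hs.eq_or_lt with rfl | hs
    · obtain rfl : t = 1 := by linarith
      simpa using hc'
    · positivity
  · have h1 := mul_le_mul_of_nonneg_left (hbc v) hs
    have h2 := mul_le_mul_of_nonneg_left (hbc' v) ht
    simp only [add_apply, smul_apply, smul_eq_mul]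
    linarith

/-- The inner product on `E` obtained from an inner product `b` on `V` and a linear embedding
`D : V → E` with left inverse `B`: it is `b` on the range of `D`, the inner product of `E` on the
kernel of `B`, and makes the two orthogonal. -/
noncomputable def pushforwardForm (b : V →L[ℝ] V →L[ℝ] ℝ) (D : V →L[ℝ] E) (B : E →L[ℝ] V) :
    E →L[ℝ] E →L[ℝ] ℝ :=
  b.bilinearComp B B + (innerForm E).bilinearComp (ContinuousLinearMap.id ℝ E - D ∘L B)
    (ContinuousLinearMap.id ℝ E - D ∘L B)

theorem pushforwardForm_apply (b : V →L[ℝ] V →L[ℝ] ℝ) (D : V →L[ℝ] E) (B : E →L[ℝ] V) (u v : E) :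
    pushforwardForm b D B u v = b (B u) (B v) + inner ℝ (u - D (B u)) (v - D (B v)) := rfl

theorem pushforwardForm_map {b : V →L[ℝ] V →L[ℝ] ℝ} {D : V →L[ℝ] E} {B : E →L[ℝ] V}
    (h : B ∘L D = ContinuousLinearMap.id ℝ V) (u v : V) :
    pushforwardForm b D B (D u) (D v) = b u v := by
  have h' : ∀ u, B (D u) = u := fun u => congrArg (fun A : V →L[ℝ] V => A u) h
  simp [pushforwardForm_apply, h']

theorem IsAdmissibleInner.pushforwardForm {b : V →L[ℝ] V →L[ℝ] ℝ} (hb : IsAdmissibleInner b)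
    (D : V →L[ℝ] E) (B : E →L[ℝ] V) : IsAdmissibleInner (pushforwardForm b D B) := by
  obtain ⟨hs, c, hc, hbc⟩ := hb
  refine ⟨fun u v => ?_, c / (‖D‖ ^ 2 + c), by positivity, fun v => ?_⟩
  · rw [pushforwardForm_apply, pushforwardForm_apply, hs, real_inner_comm]
  · rw [pushforwardForm_apply, real_inner_self_eq_norm_sq, div_mul_eq_mul_div,
      div_le_iff₀ (by positivity)]
    set e := ‖v - D (B v)‖
    have h1 : ‖v‖ ≤ ‖D‖ * ‖B v‖ + e := by
      calc ‖v‖ = ‖D (B v) + (v - D (B v))‖ := by simp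
        _ ≤ ‖D (B v)‖ + e := norm_add_le _ _
        _ ≤ _ := by gcongr; exact D.le_opNorm _
    calc c * ‖v‖ ^ 2 ≤ c * (‖D‖ * ‖B v‖ + e) ^ 2 := by gcongr
      _ ≤ (c * ‖B v‖ ^ 2 + e ^ 2) * (‖D‖ ^ 2 + c) := by
        nlinarith [sq_nonneg (‖D‖ * e - c * ‖B v‖)]
      _ ≤ _ := by gcongr; exact hbc _

theorem ContDiff.clm_flip {W W' W'' : Type*} [NormedAddCommGroup W] [NormedSpace ℝ W]
    [NormedAddCommGroup W'] [NormedSpace ℝ W'] [NormedAddCommGroup W''] [NormedSpace ℝ W'']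
    {n : WithTop ℕ∞} {b : W'' → W →L[ℝ] W' →L[ℝ] ℝ} (hb : ContDiff ℝ n b) :
    ContDiff ℝ n fun q => (b q).flip :=
  (ContinuousLinearMap.flipₗᵢ ℝ W W' ℝ).contDiff.comp hb

theorem ContDiff.bilinearComp {W : Type*} [NormedAddCommGroup W] [NormedSpace ℝ W]
    {n : WithTop ℕ∞} {b : W → V →L[ℝ] V →L[ℝ] ℝ} {B : W → E →L[ℝ] V} (hb : ContDiff ℝ n b)
    (hB : ContDiff ℝ n B) : ContDiff ℝ n fun q => (b q).bilinearComp (B q) (B q) :=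
  ((hb.clm_comp hB).clm_flip.clm_comp hB).clm_flip

theorem contDiff_pushforwardForm {n : WithTop ℕ∞} : ContDiff ℝ n
    fun q : (V →L[ℝ] V →L[ℝ] ℝ) × (V →L[ℝ] E) × (E →L[ℝ] V) =>
      pushforwardForm q.1 q.2.1 q.2.2 := by
  have h : ContDiff ℝ n fun q : (V →L[ℝ] V →L[ℝ] ℝ) × (V →L[ℝ] E) × (E →L[ℝ] V) =>
      ContinuousLinearMap.id ℝ E - q.2.1 ∘L q.2.2 :=
    contDiff_const.sub (contDiff_snd.fst.clm_comp contDiff_snd.snd)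
  exact (contDiff_fst.bilinearComp contDiff_snd.snd).add (contDiff_const.bilinearComp h)

theorem LeafwiseContDiffOn.pushforwardForm {H P : Type*} [NormedAddCommGroup H]
    [NormedSpace ℝ H] [TopologicalSpace P] {r : ℕ∞} {W : Set (H × P)}
    {b : H × P → V →L[ℝ] V →L[ℝ] ℝ} {D : H × P → V →L[ℝ] E} {B : H × P → E →L[ℝ] V}
    (hb : LeafwiseContDiffOn r b W) (hD : LeafwiseContDiffOn r D W)
    (hB : LeafwiseContDiffOn r B W) (hW : IsOpen W) :
    LeafwiseContDiffOn r (fun p => pushforwardForm (b p) (D p) (B p)) W := by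
  have h1 := hb.prodMk (hD.prodMk hB hW) hW
  have h2 := contDiff_pushforwardForm (V := V) (E := E) (n := r)
  -- Elaborated without the expected type, which would be unfolded at great cost.
  have h3 := LeafwiseContDiffOn.contDiff_comp h2 h1 hW
  exact h3

/-- A left inverse `A` of a linear map is corrected to a left inverse of the nearby linear maps `D`,
depending smoothly on `D`. -/
theorem exists_smooth_leftInverse [CompleteSpace V] (A : E →L[ℝ] V) :
    ∃ (O : Set (V →L[ℝ] E)) (B : (V →L[ℝ] E) → E →L[ℝ] V), IsOpen O ∧
      (∀ D, A ∘L D = ContinuousLinearMap.id ℝ V → D ∈ O) ∧ (∀ n, ContDiffOn ℝ n B O) ∧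
      ∀ D ∈ O, B D ∘L D = ContinuousLinearMap.id ℝ V := by
  have hcont : ∀ n, ContDiff ℝ n fun D : V →L[ℝ] E => A ∘L D := fun n =>
    contDiff_const.clm_comp contDiff_id
  refine ⟨(fun D => A ∘L D) ⁻¹' range ((↑) : (V ≃L[ℝ] V) → V →L[ℝ] V),
    fun D => (A ∘L D).inverse ∘L A, ContinuousLinearEquiv.isOpen.preimage (hcont 0).continuous,
    fun D hD => ⟨ContinuousLinearEquiv.refl ℝ V, hD.symm⟩, ?_, ?_⟩
  · rintro n D ⟨e, he⟩
    have hinv : ContDiffAt ℝ n ContinuousLinearMap.inverse (A ∘L D) := by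
      rw [← show (e : V →L[ℝ] V) = A ∘L D from he]
      exact contDiffAt_map_inverse e
    exact ((hinv.comp D (hcont n).contDiffAt).clm_comp contDiffAt_const).contDiffWithinAt
  · rintro D ⟨e, he⟩
    show (A ∘L D).inverse ∘L (A ∘L D) = _
    rw [← show (e : V →L[ℝ] V) = A ∘L D from he, ContinuousLinearMap.inverse_equiv]
    ext v
    simp

end InnerProducts

namespace HilbertLamination

variable {k : ℕ∞} {X : Type*} [TopologicalSpace X] {ι : Type*} {H P : ι → Type*}
  [∀ i, NormedAddCommGroup (H i)] [∀ i, InnerProductSpace ℝ (H i)] [∀ i, TopologicalSpace (P i)]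
  {L : HilbertLamination k X H P} {r : ℕ∞}
  {E : Type*} [NormedAddCommGroup E] [InnerProductSpace ℝ E]

/-- The leafwise differentials of a map in two foliated charts differ by the leafwise differential
of the change of coordinates. -/
theorem leafDifferential_eq_comp (hk : 1 ≤ k) {φ : X → E} (hφ : L.IsContDiff k φ) {i j : ι}
    {p : H i × P i} (hp : (L.chart i).symm p ∈ (L.chart j).source) :
    L.leafDifferential φ i p = L.leafDifferential φ j (L.chart j ((L.chart i).symm p)) ∘L
      leafwiseFDeriv (fun q : H i × P i => (L.chart j ((L.chart i).symm q)).1) p := by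
  have hk0 : (k : WithTop ℕ∞) ≠ 0 := by exact_mod_cast (zero_lt_one.trans_le hk).ne'
  obtain ⟨W, hW, hpW, hWs, hWl, -, g, hg⟩ := L.exists_isOpen_transverse hp
  have h1 := ((hWl.contDiffAt hW hpW).differentiableAt hk0).hasFDerivAt
  have h2 := (((hφ j).contDiffAt isOpen_univ
    (mem_univ (L.chart j ((L.chart i).symm p)))).differentiableAt hk0).hasFDerivAt
  refine HasFDerivAt.fderiv ((HasFDerivAt.comp p.1
    (f := fun x : H i => (L.chart j ((L.chart i).symm (x, p.2))).1) h2 h1).congr_of_eventuallyEq ?_)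
  filter_upwards [(hW.plaque p.2).mem_nhds hpW] with x hx
  have hx2 : (L.chart j ((L.chart i).symm p)).2 = (L.chart j ((L.chart i).symm (x, p.2))).2 :=
    (hg p hpW).trans (hg _ hx).symm
  simp only [Function.comp, hx2, Prod.mk.eta]
  rw [(L.chart j).left_inv (hWs _ hx)]

namespace LeafwiseMetric

/-- The inner products on `E` which induce the metric `g` on the tangent space of the leaf at `x`,
through the leafwise differential of `φ`. -/
def extensionsAt (g : L.LeafwiseMetric r) (φ : X → E) (x : X) : Set (E →L[ℝ] E →L[ℝ] ℝ) :=
  {b | IsAdmissibleInner b ∧ ∀ i p, (L.chart i).symm p = x → ∀ u v,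
    b (L.leafDifferential φ i p u) (L.leafDifferential φ i p v) = g.form i p u v}

theorem convex_extensionsAt (g : L.LeafwiseMetric r) (φ : X → E) (x : X) :
    Convex ℝ (g.extensionsAt φ x) := by
  intro b hb b' hb' s t hs ht hst
  refine ⟨convex_isAdmissibleInner hb.1 hb'.1 hs ht hst, fun i p hp u v => ?_⟩
  simp only [add_apply, smul_apply, smul_eq_mul,
    hb.2 i p hp u v, hb'.2 i p hp u v]
  rw [← add_mul, hst, one_mul]

/-- Whether an inner product induces the metric `g` can be checked in one foliated chart. -/
theorem mem_extensionsAt_of_chart (hk : 1 ≤ k) {g : L.LeafwiseMetric r} {φ : X → E}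
    (hφ : L.IsContDiff k φ) {x : X} {b : E →L[ℝ] E →L[ℝ] ℝ} (hb : IsAdmissibleInner b) {j : ι}
    (hx : x ∈ (L.chart j).source)
    (h : ∀ u v, b (L.leafDifferential φ j (L.chart j x) u)
      (L.leafDifferential φ j (L.chart j x) v) = g.form j (L.chart j x) u v) :
    b ∈ g.extensionsAt φ x := by
  refine ⟨hb, fun i p hp u v => ?_⟩
  subst hp
  rw [g.compatible i j p (L.mem_trans_source.2 hx), leafDifferential_eq_comp hk hφ hx]
  exact h _ _

/-- Near `x`, the metric extends to inner products on `E` that vary in a `C^r` fashion along the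
lamination. One derivative is lost, as the extension depends on the leafwise differential. -/
theorem exists_local_extension [∀ i, CompleteSpace (H i)] (hk : 1 ≤ k) (hr : r + 1 ≤ k)
    (g : L.LeafwiseMetric r) {φ : X → E} (hφ : L.IsContDiff k φ)
    (hA : ∀ i p, ∃ A : E →L[ℝ] H i,
      A ∘L L.leafDifferential φ i p = ContinuousLinearMap.id ℝ (H i)) (x : X) :
    ∃ Γ : X → E →L[ℝ] E →L[ℝ] ℝ, ∃ W ∈ 𝓝 x, ∀ z ∈ W,
      L.IsContDiffAt r Γ z ∧ Γ z ∈ g.extensionsAt φ z := by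
  obtain ⟨i, hi⟩ := L.cover x
  obtain ⟨A, hA⟩ := hA i (L.chart i x)
  obtain ⟨O, B, hO, hAO, hB, hBO⟩ := exists_smooth_leftInverse A
  have hD : LeafwiseContDiffOn r (L.leafDifferential φ i) univ :=
    (hφ i).leafwiseFDeriv isOpen_univ hr
  have hDc : Continuous (L.leafDifferential φ i) := continuousOn_univ.1 hD.continuousOn
  have hU : IsOpen (L.leafDifferential φ i ⁻¹' O) := hO.preimage hDc
  have hDU := hD.mono (subset_univ (L.leafDifferential φ i ⁻¹' O))
  let Γ : H i × P i → E →L[ℝ] E →L[ℝ] ℝ := fun p =>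
    pushforwardForm (g.form i p) (L.leafDifferential φ i p) (B (L.leafDifferential φ i p))
  have hΓ : LeafwiseContDiffOn r Γ (L.leafDifferential φ i ⁻¹' O) :=
    ((g.contDiff i).mono (subset_univ _)).pushforwardForm hDU
      (LeafwiseContDiffOn.contDiffOn_comp (hB r) hO hDU hU fun p hp => hp) hU
  refine ⟨fun z => Γ (L.chart i z), _, ((L.chart i).isOpen_inter_preimage hU).mem_nhds
    ⟨hi, hAO _ hA⟩, fun z hz => ⟨?_, ?_⟩⟩
  · exact IsContDiffAt.of_chart (le_self_add.trans hr) hz.1 hU hz.2 <| by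
      simpa only [L.chart_symm] using hΓ
  · exact mem_extensionsAt_of_chart hk hφ ((g.admissible i _).pushforwardForm _ _) hz.1
      (pushforwardForm_map (hBO _ hz.2))

/-- The local extensions are glued by a partition of unity, as the extensions at a point form a
convex set. -/
theorem exists_extension_along [SecondCountableTopology X] [RegularSpace X] [∀ i, T4Space (P i)]
    [Nonempty X] [∀ i, CompleteSpace (H i)] (hk : 1 ≤ k) (hr : r + 1 ≤ k)
    (g : L.LeafwiseMetric r) {φ : X → E} (hφ : L.IsContDiff k φ)
    (hA : ∀ i p, ∃ A : E →L[ℝ] H i,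
      A ∘L L.leafDifferential φ i p = ContinuousLinearMap.id ℝ (H i)) :
    ∃ Γ : X → E →L[ℝ] E →L[ℝ] ℝ, L.IsContDiff r Γ ∧ ∀ x, Γ x ∈ g.extensionsAt φ x := by
  choose Γ W hW hΓ using g.exists_local_extension hk hr hφ hA
  obtain ⟨c, μ, hμ, hμW, hfin, hsum⟩ := L.exists_partition hW
  refine ⟨fun x => ∑ᶠ n, μ n x ^ 2 • Γ (c n) x, isContDiff_iff.2 fun x => ?_, fun x => ?_⟩
  · obtain ⟨N, hN⟩ := hfin x
    refine IsContDiffAt.finsum (N := N) (fun n => ?_) ?_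
    · have hμx := (isContDiff_iff.1 (hμ n) x).of_le (le_self_add.trans hr)
      refine (hμx.smul (hμx.smul_of_tsupport (f := Γ (c n)) fun hx =>
        (hΓ _ _ (hμW n hx)).1)).congr (.of_forall fun z => ?_)
      simp only [sq, mul_smul]
    · filter_upwards [hN] with z hz n hn
      rw [hz n hn, sq, zero_mul, zero_smul]
  · exact (g.convex_extensionsAt φ x).finsum_mem (fun n => sq_nonneg _) (hsum x) fun n hn =>
      (hΓ _ _ (hμW n (subset_tsupport _ fun h => hn (by simp [h])))).2

/-- A metric along the leaves of a lamination that is embedded as a closed subspace of `E` extends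
to a metric tensor on `E`. -/
theorem exists_metricTensor [SecondCountableTopology X] [RegularSpace X] [∀ i, T4Space (P i)]
    [∀ i, CompleteSpace (H i)] (hk : 1 ≤ k) (hr : r + 1 ≤ k) (g : L.LeafwiseMetric r) {φ : X → E}
    (hφ : L.IsContDiff k φ) (hφc : IsClosedEmbedding φ)
    (hA : ∀ i p, ∃ A : E →L[ℝ] H i,
      A ∘L L.leafDifferential φ i p = ContinuousLinearMap.id ℝ (H i)) :
    ∃ G : E → E →L[ℝ] E →L[ℝ] ℝ,
      IsMetricTensor G ∧ g.IsExtendedBy φ G ∧ L.IsContDiff r fun x => G (φ x) := by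
  rcases isEmpty_or_nonempty X with hX | hX
  · exact ⟨fun _ => innerForm E, ⟨continuous_const, fun _ => isAdmissibleInner_innerForm⟩,
      fun i p => isEmptyElim ((L.chart i).symm p), isContDiff_iff.2 fun x => isEmptyElim x⟩
  · obtain ⟨Γ, hΓ, hΓg⟩ := g.exists_extension_along hk hr hφ hA
    obtain ⟨G, hG, hGφ, hGadm⟩ := hφc.exists_extension_mem_convex hΓ.continuous
      convex_isAdmissibleInner fun x => (hΓg x).1
    refine ⟨G, ⟨hG, hGadm⟩, fun i p u v => ?_, by simpa only [hGφ] using hΓ⟩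
    rw [hGφ]
    exact (hΓg _).2 i p rfl u v

end LeafwiseMetric

end HilbertLamination

end MetricExtension

theorem propositionp {k : ℕ∞} (hk : 1 ≤ k) {X : Type*} [TopologicalSpace X] [PolishSpace X]
    {ι : Type*} {H P : ι → Type*}
    [∀ i, NormedAddCommGroup (H i)] [∀ i, InnerProductSpace ℝ (H i)] [∀ i, CompleteSpace (H i)]
    [∀ i, TopologicalSpace.SeparableSpace (H i)]
    [∀ i, TopologicalSpace (P i)] [∀ i, PolishSpace (P i)]
    (L : HilbertLamination k X H P) :
    ∃ φ : X → lp (fun _ : ℕ => ℝ) 2,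
      L.IsSmoothEmbedding φ ∧
      ∀ r : ℕ∞, r + 1 ≤ k → ∀ g : L.LeafwiseMetric r,
        ∃ G : lp (fun _ : ℕ => ℝ) 2 →
            (lp (fun _ : ℕ => ℝ) 2 →L[ℝ] lp (fun _ : ℕ => ℝ) 2 →L[ℝ] ℝ),
          IsMetricTensor G ∧ g.IsExtendedBy φ G ∧ L.IsContDiff r (fun x => G (φ x)) := by
  obtain ⟨φ, hφ, hφc, hA⟩ := L.exists_isClosedEmbedding hk
  refine ⟨φ, ⟨hφ, hφc.isEmbedding, fun i p => ?_, fun i p => ?_⟩, fun r hr g =>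
    g.exists_metricTensor hk hr hφ hφc hA⟩
  · obtain ⟨A, hA⟩ := hA i p
    exact Function.LeftInverse.injective (g := A) fun u =>
      congrArg (fun T : H i →L[ℝ] H i => T u) hA
  · obtain ⟨A, hA⟩ := hA i p
    have hA' : ∀ u, A (L.leafDifferential φ i p u) = u := fun u =>
      congrArg (fun T : H i →L[ℝ] H i => T u) hA
    have : range (L.leafDifferential φ i p) = {y | L.leafDifferential φ i p (A y) = y} := by
      ext y
      refine ⟨?_, fun hy => ⟨A y, hy⟩⟩
      rintro ⟨u, rfl⟩
      simp [hA']
    rw [this]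
    exact isClosed_eq ((L.leafDifferential φ i p).continuous.comp A.continuous) continuous_id
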